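/- Let $K$ be a smooth knot in $\mathbb{R}^3$ of length $l$, given by an $l$-periodic smooth arc-length parametrization $\mathbf r$, injective on $[0,l)$, with tangent vector $\mathbf t=\mathbf r'$ and a smooth unit vector field $\mathbf b$ along $K$ orthogonal to $\mathbf r'$ and $\mathbf r''$ (the binormal; on going once around $K$ it may return to its negative). Put $\mathbf n=\mathbf b\times\mathbf t$ and define $\kappa,\tau$ by $\mathbf t'=\kappa\mathbf n$, $\mathbf b'=-\tau\mathbf n$ (so $\kappa$ may vanish or be negative). Assume that $\mathbf t'$ and $\mathbf b'$ never vanish simultaneously, that each vanishes at only finitely many points of $K$, and that the vectors $\pm\mathbf t$ at the points where $\mathbf t'=0$ are pairwise distinct, and likewise the vectors $\pm\mathbf b$ at the points where $\mathbf b'=0$. Let $\mathbf d=(\kappa\mathbf b+\tau\mathbf t)/\sqrt{\kappa^2+\tau^2}$ be the unit Darboux vector. The curves on $S^2$ described by $\mathbf t,\mathbf n,\mathbf d$ are the tantrix $T$, the notrix $N$ and the Darboux indicatrix $D$; $-N$ and $-D$ are the anti-notrix and the anti-Darboux indicatrix. A cusp of $D$ is a parameter at which the unit tangent vector of $D$ has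 one-sided limits and these are opposite to each other. Assume that no two cusps of $D$ (at different points of $K$) coincide and that no cusp of $D$ coincides with a cusp of $-D$. For $\mathbf v\in S^2$, the tantrix-bridge map counts the points of $K$ (with parameter in $[0,l)$, value in $\mathbb N\cup\{\infty\}$) that give stationary points of the projection of $T$ onto the axis defined by $\mathbf v$; a point where $\mathbf t'=0$ is counted if and only if $\mathbf n\perp\mathbf v$. The tantrix-inflection map counts in the same way the points that give inflection points (acceleration parallel to velocity) and cusps (velocity zero) of the projection of $T$ onto the plane orthogonal to $\mathbf v$; a point where $\mathbf t'=0$ is counted if and only if $\mathbf t\perp\mathbf v$. The tantrix-bridge graph and the tantrix-inflection graph are the sets of points of $S^2$ that have no open neighbourhood in $S^2$ on which the respective map is constant. The geodesic curvature $\tau/\kappa$ of $T$ is regarded as a function with values in $\mathbb R\cup\{\infty\}$: at a point where $\kappa=0$, stationary means that $\kappa/\tau$ is stationary. Then: (1) The tantrix-bridge graph is the union of the Darboux indicatrix and the anti-Darboux indicatrix. (2) If moreover $D$ has a cusp at every point where $\tau/\kappa$ is stationary, then the tantrix-inflection graph is the union of the notrix, the anti-notrix, and the great circles tangent to the notrix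 and the anti-notrix at the points where $\tau/\kappa$ is stationary. -/

import Mathlib

noncomputable section

open scoped ContDiff Topology

/-- Euclidean three-space. -/
abbrev E3 : Type := EuclideanSpace ℝ (Fin 3)

/-- The unit sphere of Euclidean three-space. -/
abbrev S2 : Type := Metric.sphere (0 : E3) 1

/-- The vector product of Euclidean three-space. -/
def cross3 (x y : E3) : E3 := WithLp.toLp 2 (crossProduct x.ofLp y.ofLp)

/-- A smooth knot, parametrized by arc length as an `l`-periodic curve `r`, with a smooth choice `b`
of unit normals to the osculating planes. No sign condition on the curvature is made, and `b` is
not required to be periodic: it follows from the fields below that it is periodic up to sign. -/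
structure SmoothKnot where
  /-- the length of the knot -/
  l : ℝ
  l_pos : 0 < l
  /-- the position vector as a function of arc length -/
  r : ℝ → E3
  r_smooth : ContDiff ℝ ∞ r
  r_periodic : Function.Periodic r l
  r_injOn : Set.InjOn r (Set.Ico 0 l)
  r_unit_speed : ∀ s, ‖deriv r s‖ = 1
  /-- the binormal vector -/
  b : ℝ → E3
  b_smooth : ContDiff ℝ ∞ b
  b_unit : ∀ s, ‖b s‖ = 1
  b_orth_velocity : ∀ s, inner ℝ (b s) (deriv r s) = 0
  b_orth_acceleration : ∀ s, inner ℝ (b s) (deriv (deriv r) s) = 0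
  not_both_zero : ∀ s, ¬ (deriv (deriv r) s = 0 ∧ deriv b s = 0)
  finite_t : {s ∈ Set.Ico 0 l | deriv (deriv r) s = 0}.Finite
  finite_b : {s ∈ Set.Ico 0 l | deriv b s = 0}.Finite
  /-- The vectors `± t` at the points where `t'` vanishes are pairwise distinct. -/
  distinct_t : ∀ s₁ ∈ Set.Ico 0 l, ∀ s₂ ∈ Set.Ico 0 l,
    deriv (deriv r) s₁ = 0 → deriv (deriv r) s₂ = 0 →
    (deriv r s₁ = deriv r s₂ ∨ deriv r s₁ = - deriv r s₂) → s₁ = s₂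
  /-- The vectors `± b` at the points where `b'` vanishes are pairwise distinct. -/
  distinct_b : ∀ s₁ ∈ Set.Ico 0 l, ∀ s₂ ∈ Set.Ico 0 l,
    deriv b s₁ = 0 → deriv b s₂ = 0 → (b s₁ = b s₂ ∨ b s₁ = - b s₂) → s₁ = s₂

/-- The graph of a map on the sphere: the points without a neighbourhood on which the map is
constant. -/
def sphereMapGraph {α : Type*} (f : S2 → α) : Set S2 :=
  {p | ¬ ∃ U : Set S2, IsOpen U ∧ p ∈ U ∧ ∃ c : α, ∀ q ∈ U, f q = c}

/-- The great circle tangent at `γ s` to the spherical curve `γ` (used where `γ' s ≠ 0`). -/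
def tangentGreatCircle (γ : ℝ → E3) (s : ℝ) : Set E3 :=
  {x | ‖x‖ = 1 ∧ x ∈ Submodule.span ℝ {γ s, deriv γ s}}

/-- The smooth curve `γ` has a cusp at `s`: its unit tangent vector has one-sided limits at `s`,
and these are opposite, so that `γ` reverses its direction at `s`. (In particular `γ'` does not
vanish at the points near `s` other than `s`.) -/
def HasCuspAt (γ : ℝ → E3) (s : ℝ) : Prop :=
  ∃ e : E3, ‖e‖ = 1 ∧
    Filter.Tendsto (fun u => ‖deriv γ u‖⁻¹ • deriv γ u) (𝓝[>] s) (𝓝 e) ∧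
    Filter.Tendsto (fun u => ‖deriv γ u‖⁻¹ • deriv γ u) (𝓝[<] s) (𝓝 (-e))

namespace SmoothKnot

/-- The tangent vector; as a spherical curve, the tantrix. -/
def t (K : SmoothKnot) (s : ℝ) : E3 := deriv K.r s

/-- The normal vector `n = b × t`; as a spherical curve, the notrix. -/
def n (K : SmoothKnot) (s : ℝ) : E3 := cross3 (K.b s) (K.t s)

/-- The signed curvature, `t' = κ n`. -/
def curvature (K : SmoothKnot) (s : ℝ) : ℝ := inner ℝ (deriv K.t s) (K.n s)

/-- The torsion, `b' = - τ n`. -/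
def torsion (K : SmoothKnot) (s : ℝ) : ℝ := - inner ℝ (deriv K.b s) (K.n s)

/-- The angular velocity of the Frenet motion. -/
def angularVelocity (K : SmoothKnot) (s : ℝ) : ℝ :=
  Real.sqrt (K.curvature s ^ 2 + K.torsion s ^ 2)

/-- The unit Darboux vector `d`, `ω d = κ b + τ t`; as a spherical curve, the Darboux
indicatrix. -/
def d (K : SmoothKnot) (s : ℝ) : E3 :=
  (K.angularVelocity s)⁻¹ • (K.curvature s • K.b s + K.torsion s • K.t s)

/-- The geodesic curvature `τ / κ` of the tantrix is stationary at `s`. It is regarded as a function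
with values in `ℝ ∪ {∞}` (the projective line), so where `κ` vanishes the stationarity of `κ / τ` is
meant. -/
def GeodesicCurvatureStationaryAt (K : SmoothKnot) (s : ℝ) : Prop :=
  (K.curvature s ≠ 0 ∧ deriv (fun u => K.torsion u / K.curvature u) s = 0) ∨
  (K.curvature s = 0 ∧ deriv (fun u => K.curvature u / K.torsion u) s = 0)

/-- The point of parameter `s` counts as a stationary point of the projection of the tantrix onto
the axis of `v`. Where `t'` vanishes (at a cusp of the tantrix), it counts if and only if the
direction `n` of the tantrix is orthogonal to the axis. -/
def IsTantrixStationary (K : SmoothKnot) (v : E3) (s : ℝ) : Prop :=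
  (deriv K.t s ≠ 0 ∧ deriv (fun u => inner ℝ v (K.t u)) s = 0) ∨
  (deriv K.t s = 0 ∧ inner ℝ v (K.n s) = 0)

/-- The projection of the tantrix onto the plane orthogonal to `v`. -/
def tantrixProjection (K : SmoothKnot) (v : E3) (s : ℝ) : E3 :=
  (Submodule.span ℝ {v})ᗮ.starProjection (K.t s)

/-- The point of parameter `s` counts as a cusp (velocity zero) or an inflection point (acceleration
parallel to velocity) of the projection of the tantrix onto the plane orthogonal to `v`. Where `t'`
vanishes (at a cusp of the tantrix), it counts if and only if `t` lies on the great circle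
orthogonal to `v`. -/
def IsTantrixInflection (K : SmoothKnot) (v : E3) (s : ℝ) : Prop :=
  (deriv K.t s ≠ 0 ∧
    (deriv (K.tantrixProjection v) s = 0 ∨
      deriv (deriv (K.tantrixProjection v)) s
        ∈ Submodule.span ℝ {deriv (K.tantrixProjection v) s})) ∨
  (deriv K.t s = 0 ∧ inner ℝ v (K.t s) = 0)

/-- The tantrix-bridge map. -/
def tantrixBridgeMap (K : SmoothKnot) (v : S2) : ℕ∞ :=
  {s ∈ Set.Ico 0 K.l | K.IsTantrixStationary v s}.encard

/-- The tantrix-inflection map. -/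
def tantrixInflectionMap (K : SmoothKnot) (v : S2) : ℕ∞ :=
  {s ∈ Set.Ico 0 K.l | K.IsTantrixInflection v s}.encard

/-- The tantrix-bridge graph. -/
def tantrixBridgeGraph (K : SmoothKnot) : Set S2 := sphereMapGraph K.tantrixBridgeMap

/-- The tantrix-inflection graph. -/
def tantrixInflectionGraph (K : SmoothKnot) : Set S2 := sphereMapGraph K.tantrixInflectionMap

/-- No two cusps of the Darboux indicatrix coincide, and no cusp of the Darboux indicatrix coincides
with a cusp of the anti-Darboux indicatrix. -/
def DarbouxCuspsDistinct (K : SmoothKnot) : Prop :=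
  ∀ s₁ ∈ Set.Ico 0 K.l, ∀ s₂ ∈ Set.Ico 0 K.l, HasCuspAt K.d s₁ → HasCuspAt K.d s₂ →
    (K.d s₁ = K.d s₂ ∨ K.d s₁ = - K.d s₂) → s₁ = s₂

/-- Wherever the geodesic curvature of the tantrix is stationary, the Darboux indicatrix has a
cusp. -/
def StationaryPointsAreCusps (K : SmoothKnot) : Prop :=
  ∀ s, K.GeodesicCurvatureStationaryAt s → HasCuspAt K.d s

end SmoothKnot

end

/-!
Put `ω = √(κ² + τ²)`, which never vanishes, and `e = n' / ω`. Then `(n, e, d)` is an orthonormal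
frame along the knot, and `d' = λ e` for a function `λ` (`SmoothKnot.darbouxSpeed`) which vanishes
exactly where `τ / κ` is stationary. A point counts for the bridge map at `v` if and only if
`⟪v, n⟫ = 0` (`SmoothKnot.isTantrixStationary_iff`), and for the inflection map if and only if
`⟪v, d⟫ = 0` (`SmoothKnot.isTantrixInflection_iff`). So both maps have the form
`v ↦ #{s ∈ [0, l) | ⟪v, γ s⟫ = 0}`, the count `orthCount` of a curve `γ` that is periodic up to a
sign and has a derivative parallel to `e`.

Where all zeros of `⟪v, γ⟫` are simple, the count is locally constant
(`IsSignPeriodic.eventually_orthCount_eq`). A degenerate zero of `⟪v, n⟫` means `v = ± d`, and one of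
`⟪v, d⟫` means `v = ± n` or `λ = 0`; in the latter case `v` lies on the great circle orthogonal to
`d`, which is the tangent great circle of the notrix. Hence the graphs are contained in the asserted
sets.

For the converse inclusions let first `v = ± d s₀` and `γ = n`, or `v = ± n s₀` with `λ s₀ ≠ 0` and
`γ = d`. Then `s₀` is a degenerate zero of `⟪v, γ⟫`, but a simple zero of `⟪e s₀, γ⟫`. Comparing the
zeros at `v + ε e s₀` and `v - ε e s₀` with those at `v`, every zero gives rise to at least two, and
`s₀` to at least three, so that the two counts cannot both be equal to the count at `v`
(`IsSignPeriodic.not_eventually_orthCount_eq_of_degenerate`). This requires a finite count. For `n`,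
a locally constant count is finite because the cone over the Darboux indicatrix has a dense
complement; for `d`, all zeros are isolated because those of `λ` are.

Finally let `v` be orthogonal to `d s₀` with `λ s₀ = 0`. Since `D` has a cusp at `s₀`, the function
`λ` changes its sign there, so for `v ≠ ± n s₀` the function `⟪v, d⟫` has an extremum with value
zero at `s₀`. If its other zeros are simple, then moving `v` slightly to one side turns this zero into two and preserves
the others (`IsSignPeriodic.not_eventually_orthCount_eq_of_extremum`). As distinct cusps define
distinct great circles and the graph is closed, the remaining points of the circle are reached as
limits (`SmoothKnot.StationaryPointsAreCusps.not_eventually_of_stationary`).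
-/

noncomputable section

open scoped ContDiff Topology

/-! ### Counting zeros over a period -/

/-- The number of parameters in `[0, l)` at which the curve `γ` is orthogonal to `v`. -/
def orthCount (γ : ℝ → E3) (l : ℝ) (v : E3) : ℕ∞ :=
  {s ∈ Set.Ico 0 l | inner ℝ v (γ s) = 0}.encard

theorem encard_inter_Ico_eq {A : Set ℝ} {l : ℝ} (hl : 0 < l) (hA : ∀ s, s + l ∈ A ↔ s ∈ A)
    (a : ℝ) : (A ∩ Set.Ico 0 l).encard = (A ∩ Set.Ico a (a + l)).encard := by
  have hz : ∀ (k : ℤ) s, s - k • l ∈ A ↔ s ∈ A := by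
    have hp : Function.Periodic (fun s => s ∈ A) l := fun s => propext (hA s)
    intro k s
    exact iff_of_eq (hp.sub_zsmul_eq k)
  have himg : toIcoMod hl a '' (A ∩ Set.Ico 0 l) = A ∩ Set.Ico a (a + l) := by
    ext s
    constructor
    · rintro ⟨u, ⟨hu, -⟩, rfl⟩
      exact ⟨(hz _ _).2 hu, toIcoMod_mem_Ico hl a u⟩
    · rintro ⟨hs, hI⟩
      refine ⟨toIcoMod hl 0 s, ⟨(hz _ _).2 hs, by simpa using toIcoMod_mem_Ico hl 0 s⟩, ?_⟩
      rw [toIcoMod_toIcoMod]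
      exact (toIcoMod_eq_self hl).2 hI
  rw [← himg, Set.InjOn.encard_image]
  rintro x ⟨-, hx⟩ y ⟨-, hy⟩ hxy
  have h := congrArg (toIcoMod hl 0) hxy
  rw [toIcoMod_toIcoMod, toIcoMod_toIcoMod, (toIcoMod_eq_self hl).2 (by simpa using hx),
    (toIcoMod_eq_self hl).2 (by simpa using hy)] at h
  exact h

theorem sum_encard_inter_le {A J : Set ℝ} {I : ℝ → Set ℝ} (Z : Finset ℝ)
    (hJ : ∀ z ∈ Z, I z ⊆ J) (hd : (Z : Set ℝ).PairwiseDisjoint I) :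
    ∑ z ∈ Z, (A ∩ I z).encard ≤ (A ∩ J).encard := by
  have h : ∑ z ∈ Z, (A ∩ I z).encard = (⋃ z ∈ Z, A ∩ I z).encard := by
    induction Z using Finset.induction_on with
    | empty => simp
    | insert z Z hz ih =>
      rw [Finset.sum_insert hz, Finset.set_biUnion_insert, Set.encard_union_eq, ih]
      · exact fun y hy => hJ y (Finset.mem_insert_of_mem hy)
      · exact hd.subset (by simp)
      · rw [Set.disjoint_iUnion₂_right]
        intro y hy
        refine (hd (by simp) (by simp [hy]) ?_).mono Set.inter_subset_right Set.inter_subset_right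
        rintro rfl
        exact hz hy
  rw [h]
  exact Set.encard_le_encard (Set.iUnion₂_subset fun z hz =>
    Set.inter_subset_inter_right A (hJ z hz))

theorem two_le_encard {α : Type*} {A : Set α} {x y : α} (hx : x ∈ A) (hy : y ∈ A) (h : x ≠ y) :
    2 ≤ A.encard := by
  rw [← Set.encard_pair h]
  exact Set.encard_le_encard (by rintro z (rfl | rfl) <;> assumption)

theorem exists_zero_of_mul_neg {f : ℝ → ℝ} (hf : Continuous f) {p q : ℝ} (hpq : p ≤ q)
    (h : f p * f q < 0) : ∃ u ∈ Set.Ioo p q, f u = 0 := by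
  rcases mul_neg_iff.1 h with ⟨h1, h2⟩ | ⟨h1, h2⟩
  · exact intermediate_value_Ioo' hpq hf.continuousOn ⟨h2, h1⟩
  · exact intermediate_value_Ioo hpq hf.continuousOn ⟨h1, h2⟩

/-- A curve whose zero counts are well defined on the circle of length `l`: it is continuously
differentiable and periodic up to sign. -/
structure IsSignPeriodic (γ : ℝ → E3) (l : ℝ) : Prop where
  pos : 0 < l
  contDiff : ContDiff ℝ 1 γ
  add_eq : ∀ s, γ (s + l) = γ s ∨ γ (s + l) = - γ s

namespace IsSignPeriodic

variable {γ : ℝ → E3} {l : ℝ}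

theorem continuous_inner (h : IsSignPeriodic γ l) (v : E3) :
    Continuous fun s => inner ℝ v (γ s) :=
  continuous_const.inner h.contDiff.continuous

theorem hasDerivAt_inner (h : IsSignPeriodic γ l) (v : E3) (s : ℝ) :
    HasDerivAt (fun s => inner ℝ v (γ s)) (inner ℝ v (deriv γ s)) s := by
  simpa using (hasDerivAt_const s v).inner ℝ
    ((h.contDiff.differentiable one_ne_zero) s).hasDerivAt

theorem orthCount_eq (h : IsSignPeriodic γ l) (v : E3) (a : ℝ) :
    orthCount γ l v = ({s | inner ℝ v (γ s) = 0} ∩ Set.Ico a (a + l)).encard := by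
  rw [← encard_inter_Ico_eq h.pos _ a, orthCount, Set.inter_comm]
  · rfl
  · intro s
    rcases h.add_eq s with hs | hs <;> simp [hs]

theorem orthCount_smul {c : ℝ} (hc : c ≠ 0) (v : E3) :
    orthCount γ l (c • v) = orthCount γ l v := by
  simp [orthCount, real_inner_smul_left, hc]

/-- If only finitely many parameters count at `v`, a whole period can be chosen whose end points
do not count, and the parameters that count are enclosed in disjoint intervals inside this
period. -/
theorem exists_isolating (h : IsSignPeriodic γ l) {v : E3} (hfin : orthCount γ l v ≠ ⊤)
    {s₀ : ℝ} (hs₀ : inner ℝ v (γ s₀) = 0) :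
    ∃ (Z : Finset ℝ) (δ : ℝ), 0 < δ ∧ s₀ ∈ Z ∧ orthCount γ l v = Z.card ∧
      (∀ z ∈ Z, inner ℝ v (γ z) = 0 ∧ |z - s₀| < l) ∧
      (∀ z ∈ Z, ∀ u ∈ Set.Icc (z - δ) (z + δ), inner ℝ v (γ u) = 0 → u = z) ∧
      ∀ x, ∑ z ∈ Z, ({s | inner ℝ x (γ s) = 0} ∩ Set.Ioo (z - δ) (z + δ)).encard
        ≤ orthCount γ l x := by
  have hl := h.pos
  have hfin' : ∀ a, ({s | inner ℝ v (γ s) = 0} ∩ Set.Ico a (a + l)).Finite := by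
    intro a
    rw [h.orthCount_eq v a] at hfin
    exact Set.encard_ne_top_iff.1 hfin
  obtain ⟨a, ⟨ha1, ha2⟩, ha⟩ : ∃ a ∈ Set.Ioo (s₀ - l) s₀, inner ℝ v (γ a) ≠ 0 := by
    by_contra! hcon
    refine Set.Ioo_infinite (show s₀ - l < s₀ by linarith) ((hfin' (s₀ - l)).subset ?_)
    exact fun u hu => ⟨hcon u hu, hu.1.le, by linarith [hu.2]⟩
  have hal : inner ℝ v (γ (a + l)) ≠ 0 := by
    rcases h.add_eq a with hs | hs <;> simpa [hs] using ha
  classical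
  set Z : Finset ℝ := (hfin' a).toFinset with hZ
  have hmem : ∀ z, z ∈ Z ↔ inner ℝ v (γ z) = 0 ∧ a ≤ z ∧ z < a + l := by
    intro z; simp [hZ]
  have hZI : ∀ z ∈ Z, a < z ∧ z < a + l := by
    intro z hz
    obtain ⟨h1, h2, h3⟩ := (hmem z).1 hz
    exact ⟨lt_of_le_of_ne h2 (by rintro rfl; exact ha h1), h3⟩
  obtain ⟨δ, hδ, hsep⟩ : ∃ δ : ℝ, 0 < δ ∧
      ∀ p ∈ insert a (insert (a + l) Z), ∀ q ∈ insert a (insert (a + l) Z),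
        p ≠ q → 2 * δ < |p - q| := by
    have : ∀ᶠ δ : ℝ in 𝓝[>] 0, 0 < δ ∧
      ∀ p ∈ insert a (insert (a + l) Z), ∀ q ∈ insert a (insert (a + l) Z),
        p ≠ q → 2 * δ < |p - q| := by
      refine Filter.Eventually.and self_mem_nhdsWithin ?_
      refine (Filter.eventually_all_finset _).2 fun p _ =>
        (Filter.eventually_all_finset _).2 fun q _ => ?_
      by_cases hpq : p = q
      · simp [hpq]
      · have h0 : 0 < |p - q| := abs_pos.2 (sub_ne_zero.2 hpq)
        have : Filter.Tendsto (fun δ : ℝ => 2 * δ) (𝓝[>] 0) (𝓝 0) := by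
          have : Continuous fun δ : ℝ => 2 * δ := by fun_prop
          simpa using (this.tendsto 0).mono_left nhdsWithin_le_nhds
        filter_upwards [this.eventually_lt_const h0] with δ hδ _ using hδ
    exact this.exists
  have hin : ∀ z ∈ Z, a < z - δ ∧ z + δ < a + l := by
    intro z hz
    obtain ⟨h1, h2⟩ := hZI z hz
    have e1 := hsep z (by simp [hz]) a (by simp) h1.ne'
    have e2 := hsep z (by simp [hz]) (a + l) (by simp) h2.ne
    rw [abs_of_pos (by linarith)] at e1
    rw [abs_of_neg (by linarith)] at e2
    constructor <;> linarith
  refine ⟨Z, δ, hδ, (hmem _).2 ⟨hs₀, by linarith, by linarith⟩, ?_, ?_, ?_, ?_⟩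
  · rw [h.orthCount_eq v a, ← (hfin' a).encard_eq_coe_toFinset_card]
  · intro z hz
    obtain ⟨h1, h2⟩ := hZI z hz
    refine ⟨((hmem z).1 hz).1, ?_⟩
    rw [abs_lt]; constructor <;> linarith
  · intro z hz u hu hu0
    obtain ⟨h1, h2⟩ := hin z hz
    have huZ : u ∈ Z := (hmem u).2 ⟨hu0, by linarith [hu.1], by linarith [hu.2]⟩
    by_contra hne
    have := hsep u (by simp [huZ]) z (by simp [hz]) hne
    have h3 : |u - z| ≤ δ := by rw [abs_le]; constructor <;> linarith [hu.1, hu.2]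
    linarith
  · intro x
    rw [h.orthCount_eq x a]
    refine sum_encard_inter_le Z ?_ ?_
    · intro z hz u hu
      obtain ⟨h1, h2⟩ := hin z hz
      exact ⟨by linarith [hu.1], by linarith [hu.2]⟩
    · intro y hy z hz hyz
      rw [Function.onFun, Set.disjoint_left]
      rintro u ⟨h1, h2⟩ ⟨h3, h4⟩
      have := hsep y (by simp [Finset.mem_coe.1 hy]) z (by simp [Finset.mem_coe.1 hz]) hyz
      have h5 : |y - z| < 2 * δ := by rw [abs_lt]; constructor <;> linarith
      linarith

end IsSignPeriodic

/-! ### Zeros under perturbation -/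

theorem encard_inter_le_sum {A J : Set ℝ} {W : ℝ → Set ℝ} (T : Finset ℝ)
    (hJ : J ⊆ ⋃ z ∈ T, W z) : (A ∩ J).encard ≤ ∑ z ∈ T, (A ∩ W z).encard := by
  have h : (⋃ z ∈ T, A ∩ W z).encard ≤ ∑ z ∈ T, (A ∩ W z).encard := by
    classical
    clear hJ
    induction T using Finset.induction_on with
    | empty => simp
    | insert z Z hz ih =>
      rw [Finset.sum_insert hz, Finset.set_biUnion_insert]
      exact (Set.encard_union_le _ _).trans (by gcongr)
  refine (Set.encard_le_encard ?_).trans h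
  rintro s ⟨hs, hJs⟩
  obtain ⟨z, hz, hsz⟩ := Set.mem_iUnion₂.1 (hJ hJs)
  exact Set.mem_iUnion₂.2 ⟨z, hz, hs, hsz⟩

theorem eventually_sign_of_hasDerivAt {f : ℝ → ℝ} {f' z : ℝ} (hf : HasDerivAt f f' z)
    (hz : f z = 0) (hf' : f' ≠ 0) : ∀ᶠ u in 𝓝[≠] z, 0 < f' * (f u * (u - z)) := by
  have h1 : Filter.Tendsto (fun u => f' * slope f z u) (𝓝[≠] z) (𝓝 (f' * f')) :=
    (hasDerivAt_iff_tendsto_slope.1 hf).const_mul f'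
  filter_upwards [h1.eventually_const_lt (mul_self_pos.2 hf'), self_mem_nhdsWithin] with u hu hne
  have hne' : u - z ≠ 0 := sub_ne_zero.2 hne
  have : f' * (f u * (u - z)) = f' * slope f z u * (u - z) ^ 2 := by
    rw [slope_def_field, hz]; field_simp; ring
  rw [this]
  positivity

theorem exists_right_of_eventually {P : ℝ → Prop} {z δ : ℝ} (hδ : 0 < δ)
    (h : ∀ᶠ u in 𝓝[≠] z, P u) : ∃ u ∈ Set.Ioo z (z + δ), P u := by
  have h1 : ∀ᶠ u in 𝓝[>] z, P u := h.filter_mono (nhdsWithin_mono z fun u hu => ne_of_gt hu)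
  obtain ⟨u, hu⟩ := (h1.and (Ioo_mem_nhdsGT (show z < z + δ by linarith))).exists
  exact ⟨u, hu.2, hu.1⟩

theorem exists_left_of_eventually {P : ℝ → Prop} {z δ : ℝ} (hδ : 0 < δ)
    (h : ∀ᶠ u in 𝓝[≠] z, P u) : ∃ u ∈ Set.Ioo (z - δ) z, P u := by
  have h1 : ∀ᶠ u in 𝓝[<] z, P u := h.filter_mono (nhdsWithin_mono z fun u hu => ne_of_lt hu)
  obtain ⟨u, hu⟩ := (h1.and (Ioo_mem_nhdsLT (show z - δ < z by linarith))).exists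
  exact ⟨u, hu.2, hu.1⟩

theorem two_le_encard_zeros {f : ℝ → ℝ} (hf : Continuous f) {p z q : ℝ} (hpz : p < z)
    (hzq : z < q) (h1 : f p * f z < 0) (h2 : f z * f q < 0) :
    2 ≤ ({s | f s = 0} ∩ Set.Ioo p q).encard := by
  obtain ⟨x, hx, hx0⟩ := exists_zero_of_mul_neg hf hpz.le h1
  obtain ⟨y, hy, hy0⟩ := exists_zero_of_mul_neg hf hzq.le h2
  exact two_le_encard (x := x) (y := y) ⟨hx0, hx.1, hx.2.trans hzq⟩ ⟨hy0, hpz.trans hy.1, hy.2⟩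
    (hx.2.trans hy.1).ne

theorem one_le_encard_zeros {f : ℝ → ℝ} (hf : Continuous f) {p q : ℝ} (hpq : p < q)
    (h : f p * f q < 0) : 1 ≤ ({s | f s = 0} ∩ Set.Ioo p q).encard := by
  obtain ⟨x, hx, hx0⟩ := exists_zero_of_mul_neg hf hpq.le h
  exact Set.one_le_encard_iff_nonempty.2 ⟨x, hx0, hx⟩

theorem eventually_mul_pos_perturb {a b : ℝ} (ha : a ≠ 0) :
    ∀ᶠ ε : ℝ in 𝓝[>] 0, 0 < a * (a + ε * b) ∧ 0 < a * (a - ε * b) := by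
  have h1 : Filter.Tendsto (fun ε : ℝ => a * (a + ε * b)) (𝓝[>] 0) (𝓝 (a * a)) := by
    have : Continuous fun ε : ℝ => a * (a + ε * b) := by fun_prop
    simpa using (this.tendsto 0).mono_left nhdsWithin_le_nhds
  have h2 : Filter.Tendsto (fun ε : ℝ => a * (a - ε * b)) (𝓝[>] 0) (𝓝 (a * a)) := by
    have : Continuous fun ε : ℝ => a * (a - ε * b) := by fun_prop
    simpa using (this.tendsto 0).mono_left nhdsWithin_le_nhds
  exact (h1.eventually_const_lt (mul_self_pos.2 ha)).and
    (h2.eventually_const_lt (mul_self_pos.2 ha))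

/-- Near an isolated zero of `φ`, the functions `φ + ε g` and `φ - ε g` have together at least two
zeros: one each if `φ` changes its sign or `g` vanishes at the point, and otherwise two for one of
the functions, whose sign at the point is opposite to the sign of `φ` around it. -/
theorem eventually_two_le_encard_add {φ g : ℝ → ℝ} (hφ : Continuous φ) (hg : Continuous g)
    {z δ : ℝ} (hδ : 0 < δ) (hz : φ z = 0) (hl : φ (z - δ) ≠ 0) (hr : φ (z + δ) ≠ 0) :
    ∀ᶠ ε : ℝ in 𝓝[>] 0,
      2 ≤ ({s | φ s + ε * g s = 0} ∩ Set.Ioo (z - δ) (z + δ)).encard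
        + ({s | φ s - ε * g s = 0} ∩ Set.Ioo (z - δ) (z + δ)).encard := by
  filter_upwards [eventually_mul_pos_perturb (b := g (z - δ)) hl,
    eventually_mul_pos_perturb (b := g (z + δ)) hr, self_mem_nhdsWithin] with ε ⟨h1, h2⟩ ⟨h3, h4⟩ hε
  have hε : 0 < ε := hε
  have hc1 : Continuous fun s => φ s + ε * g s := by fun_prop
  have hc2 : Continuous fun s => φ s - ε * g s := by fun_prop
  have hsplit : ∀ {a b a' b' : ℝ}, a * b < 0 → 0 < a * a' → 0 < b * b' → a' * b' < 0 := by
    intro a b a' b' hab ha hb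
    by_contra! h
    nlinarith [mul_pos ha hb]
  rcases lt_or_gt_of_ne (mul_ne_zero hl hr) with hlr | hlr
  · calc (2 : ℕ∞) = 1 + 1 := by norm_num
      _ ≤ _ := add_le_add
        (one_le_encard_zeros hc1 (by linarith) (hsplit hlr h1 h3))
        (one_le_encard_zeros hc2 (by linarith) (hsplit hlr h2 h4))
  have hmem : z ∈ Set.Ioo (z - δ) (z + δ) := ⟨by linarith, by linarith⟩
  -- `φ` has the same sign at both end points
  have hside : ∀ {a b a' c : ℝ}, 0 < a * b → c * a < 0 → 0 < b * a' → c * a' < 0 := by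
    intro a b a' c hab hca hba
    have : 0 < a * a' := by
      by_contra! h
      have := mul_pos hab hba
      nlinarith [sq_nonneg b, mul_nonneg (sq_nonneg b) (neg_nonneg.2 h)]
    by_contra! h
    nlinarith [mul_nonneg h (neg_nonneg.2 hca.le), sq_nonneg c, mul_pos_of_neg_of_neg hca hca,
      mul_nonneg (sq_nonneg c) this.le]
  rcases lt_trichotomy (g z * φ (z - δ)) 0 with hgz | hgz | hgz
  · refine le_add_right (two_le_encard_zeros hc1 (z := z) (by linarith) (by linarith) ?_ ?_)
    · rw [mul_comm]; simp only [hz, zero_add, mul_assoc]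
      refine mul_neg_of_pos_of_neg hε (hside (a := φ (z - δ)) (b := φ (z - δ)) ?_ hgz h1)
      exact mul_self_pos.2 hl
    · simp only [hz, zero_add, mul_assoc]
      exact mul_neg_of_pos_of_neg hε (hside hlr hgz h3)
  · have hg0 : g z = 0 := (mul_eq_zero.1 hgz).resolve_right hl
    have h5 : 1 ≤ ({s | φ s + ε * g s = 0} ∩ Set.Ioo (z - δ) (z + δ)).encard :=
      Set.one_le_encard_iff_nonempty.2 ⟨z, by simp [hz, hg0], hmem⟩
    have h6 : 1 ≤ ({s | φ s - ε * g s = 0} ∩ Set.Ioo (z - δ) (z + δ)).encard :=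
      Set.one_le_encard_iff_nonempty.2 ⟨z, by simp [hz, hg0], hmem⟩
    exact le_trans (by norm_num) (add_le_add h5 h6)
  · have hgz' : (- g z) * φ (z - δ) < 0 := by linarith
    refine le_add_left (two_le_encard_zeros hc2 (z := z) (by linarith) (by linarith) ?_ ?_)
    · rw [mul_comm]
      have := mul_neg_of_pos_of_neg hε
        (hside (a := φ (z - δ)) (b := φ (z - δ)) (mul_self_pos.2 hl) hgz' h2)
      simp only [hz]; linarith
    · have := mul_neg_of_pos_of_neg hε (hside hlr hgz' h4)
      simp only [hz]; linarith

/-- At a degenerate zero of `φ` that is a simple zero of `g`, both `φ + ε g` and `φ - ε g` vanish,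
and the one whose slope is opposite to the sign of `φ` on the right has another zero there. -/
theorem eventually_three_le_encard_add {φ g : ℝ → ℝ} (hφ : Continuous φ) (hg : Continuous g)
    {z δ g' : ℝ} (hδ : 0 < δ) (hz : φ z = 0) (hr : φ (z + δ) ≠ 0) (hφ' : HasDerivAt φ 0 z)
    (hgz : g z = 0) (hg' : HasDerivAt g g' z) (hne : g' ≠ 0) :
    ∀ᶠ ε : ℝ in 𝓝[>] 0,
      3 ≤ ({s | φ s + ε * g s = 0} ∩ Set.Ioo (z - δ) (z + δ)).encard
        + ({s | φ s - ε * g s = 0} ∩ Set.Ioo (z - δ) (z + δ)).encard := by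
  filter_upwards [eventually_mul_pos_perturb (b := g (z + δ)) hr,
    self_mem_nhdsWithin] with ε ⟨h3, h4⟩ hε
  have hε : 0 < ε := hε
  have hmem : z ∈ Set.Ioo (z - δ) (z + δ) := ⟨by linarith, by linarith⟩
  have key : ∀ c : ℝ, c ≠ 0 → c * g' * φ (z + δ) < 0 →
      0 < φ (z + δ) * (φ (z + δ) + c * g (z + δ)) →
      2 ≤ ({s | φ s + c * g s = 0} ∩ Set.Ioo (z - δ) (z + δ)).encard := by
    intro c hc hsgn hend
    have hcont : Continuous fun s => φ s + c * g s := by fun_prop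
    have hd : HasDerivAt (fun s => φ s + c * g s) (c * g') z := by
      simpa using hφ'.fun_add (hg'.const_mul c)
    obtain ⟨u, hu, hpos⟩ := exists_right_of_eventually hδ
      (eventually_sign_of_hasDerivAt hd (by simp [hz, hgz]) (mul_ne_zero hc hne))
    have hu' : 0 < u - z := by linarith [hu.1]
    have h5 : 0 < c * g' * (φ u + c * g u) := by
      rw [← mul_assoc] at hpos
      exact pos_of_mul_pos_left hpos hu'.le
    have h6 : (φ u + c * g u) * (φ (z + δ) + c * g (z + δ)) < 0 := by
      by_contra! h
      nlinarith [mul_pos h5 hend]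
    obtain ⟨x, hx, hx0⟩ := exists_zero_of_mul_neg hcont hu.2.le h6
    exact two_le_encard (x := z) (y := x) ⟨by simp [hz, hgz], hmem⟩
      ⟨hx0, by linarith [hx.1, hu.1], hx.2⟩ (hu.1.trans hx.1).ne
  have one : ∀ c : ℝ, 1 ≤ ({s | φ s + c * g s = 0} ∩ Set.Ioo (z - δ) (z + δ)).encard :=
    fun c => Set.one_le_encard_iff_nonempty.2 ⟨z, by simp [hz, hgz], hmem⟩
  have hsub : {s | φ s - ε * g s = 0} = {s | φ s + (-ε) * g s = 0} := by
    ext s; simp [sub_eq_add_neg]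
  rw [hsub]
  rcases lt_or_gt_of_ne (mul_ne_zero hne hr) with h | h
  · calc (3 : ℕ∞) = 2 + 1 := by norm_num
      _ ≤ _ := add_le_add (key ε hε.ne' (by nlinarith) h3) (one _)
  · calc (3 : ℕ∞) = 1 + 2 := by norm_num
      _ ≤ _ := add_le_add (one _) (key (-ε) (by simpa using hε.ne') (by nlinarith)
        (by rw [neg_mul, ← sub_eq_add_neg]; exact h4))

/-- If `c φ` is nonnegative around an isolated zero of `φ` and a small perturbation makes it negative
at this zero, the perturbed function has two zeros there. -/
theorem eventually_two_le_encard_sub {φ g : ℝ → ℝ} (hφ : Continuous φ) (hg : Continuous g)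
    {z δ : ℝ} (hδ : 0 < δ) (hz : φ z = 0) (hiso : ∀ u ∈ Set.Icc (z - δ) (z + δ), φ u = 0 → u = z)
    {c : ℝ} (hsgn : ∀ᶠ u in 𝓝 z, 0 ≤ c * φ u) (hgz : 0 < c * g z) :
    ∀ᶠ ε : ℝ in 𝓝[>] 0, 2 ≤ ({s | φ s - ε * g s = 0} ∩ Set.Ioo (z - δ) (z + δ)).encard := by
  have hsgn' := hsgn.filter_mono (nhdsWithin_le_nhds (s := {z}ᶜ))
  obtain ⟨p, hp, hp0⟩ := exists_left_of_eventually hδ hsgn'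
  obtain ⟨q, hq, hq0⟩ := exists_right_of_eventually hδ hsgn'
  have hc : c ≠ 0 := by rintro rfl; simp at hgz
  have hpne : φ p ≠ 0 := fun h =>
    hp.2.ne (hiso p ⟨hp.1.le, by linarith [hp.2]⟩ h)
  have hqne : φ q ≠ 0 := fun h =>
    hq.1.ne' (hiso q ⟨by linarith [hq.1], hq.2.le⟩ h)
  have hp1 : 0 < c * φ p := lt_of_le_of_ne hp0 (mul_ne_zero hc hpne).symm
  have hq1 : 0 < c * φ q := lt_of_le_of_ne hq0 (mul_ne_zero hc hqne).symm
  filter_upwards [eventually_mul_pos_perturb (b := g p) hpne,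
    eventually_mul_pos_perturb (b := g q) hqne, self_mem_nhdsWithin] with ε ⟨_, h2⟩ ⟨_, h4⟩ hε
  have hε : 0 < ε := hε
  have hcont : Continuous fun s => φ s - ε * g s := by fun_prop
  have aux : ∀ a b : ℝ, 0 < c * a → 0 < a * b → b * (φ z - ε * g z) < 0 := by
    intro a b ha hab
    have h1 : 0 < c * b := by
      by_contra! h
      nlinarith [mul_pos ha hab, mul_nonneg (sq_nonneg a) (neg_nonneg.2 h)]
    have h2 : 0 < b * g z := by
      by_contra! h
      nlinarith [mul_pos h1 hgz, mul_nonneg (sq_nonneg c) (neg_nonneg.2 h)]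
    rw [hz]; nlinarith
  refine (two_le_encard_zeros hcont hp.2 hq.1 (aux _ _ hp1 h2)
    (by rw [mul_comm]; exact aux _ _ hq1 h4)).trans (Set.encard_le_encard ?_)
  exact Set.inter_subset_inter_right _ (Set.Ioo_subset_Ioo hp.1.le hq.2.le)

theorem tendsto_add_smul (v w : E3) (c : ℝ) :
    Filter.Tendsto (fun ε : ℝ => v + (c * ε) • w) (𝓝[>] 0) (𝓝 v) := by
  have : Continuous fun ε : ℝ => v + (c * ε) • w := by fun_prop
  simpa using (this.tendsto 0).mono_left nhdsWithin_le_nhds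

namespace IsSignPeriodic

variable {γ : ℝ → E3} {l : ℝ}

theorem eventually_one_le_encard (h : IsSignPeriodic γ l) {v : E3} {z δ : ℝ} (hδ : 0 < δ)
    (hz : inner ℝ v (γ z) = 0) (hz' : inner ℝ v (deriv γ z) ≠ 0) :
    ∀ᶠ x in 𝓝 v, 1 ≤ ({s | inner ℝ x (γ s) = 0} ∩ Set.Ioo (z - δ) (z + δ)).encard := by
  have hs := eventually_sign_of_hasDerivAt (h.hasDerivAt_inner v z) hz hz'
  obtain ⟨p, hp, hp0⟩ := exists_left_of_eventually hδ hs
  obtain ⟨q, hq, hq0⟩ := exists_right_of_eventually hδ hs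
  have hpq : inner ℝ v (γ p) * inner ℝ v (γ q) < 0 := by
    have h1 : p - z < 0 := by linarith [hp.2]
    have h2 : 0 < q - z := by linarith [hq.1]
    by_contra! hcon
    nlinarith [mul_pos hp0 hq0, mul_nonneg (mul_nonneg hcon (sq_nonneg (inner ℝ v (deriv γ z))))
      (mul_nonneg (neg_nonneg.2 h1.le) h2.le)]
  have hc : Continuous fun x : E3 => inner ℝ x (γ p) * inner ℝ x (γ q) := by fun_prop
  filter_upwards [(hc.tendsto v).eventually_lt_const hpq] with x hx
  refine (one_le_encard_zeros (h.continuous_inner x) (hp.2.trans hq.1) hx).trans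
    (Set.encard_le_encard ?_)
  exact Set.inter_subset_inter_right _ (Set.Ioo_subset_Ioo hp.1.le hq.2.le)

/-- If all zeros of `⟪v, γ⟫` are simple, there are only finitely many in a period, and no others
appear near `v`. -/
theorem orthCount_upper (h : IsSignPeriodic γ l) {v : E3}
    (hv : ∀ s, inner ℝ v (γ s) = 0 → inner ℝ v (deriv γ s) ≠ 0) :
    orthCount γ l v ≠ ⊤ ∧ ∀ᶠ x in 𝓝 v, orthCount γ l x ≤ orthCount γ l v := by
  classical
  obtain ⟨a, ha⟩ : ∃ a, inner ℝ v (γ a) ≠ 0 := by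
    by_contra! hcon
    have h1 := (h.hasDerivAt_inner v 0).deriv
    rw [show (fun s => inner ℝ v (γ s)) = fun _ => (0 : ℝ) from funext hcon] at h1
    exact hv 0 (hcon 0) (by rw [← h1]; simp)
  have hal : inner ℝ v (γ (a + l)) ≠ 0 := by
    rcases h.add_eq a with hs | hs <;> simpa [hs] using ha
  have hloc : ∀ s, ∃ W ∈ 𝓝 s, ∃ U ∈ 𝓝 v, ∀ x ∈ U,
      ({u | inner ℝ x (γ u) = 0} ∩ W).encard ≤ if inner ℝ v (γ s) = 0 then 1 else 0 := by
    intro s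
    split_ifs with hs
    · have hc : Continuous fun p : E3 × ℝ => inner ℝ p.1 (deriv γ p.2) :=
        continuous_fst.inner ((h.contDiff.continuous_deriv le_rfl).comp continuous_snd)
      have he : ∀ᶠ p : E3 × ℝ in 𝓝 (v, s), inner ℝ p.1 (deriv γ p.2) ≠ 0 :=
        (hc.tendsto (v, s)).eventually_ne (hv s hs)
      rw [nhds_prod_eq] at he
      obtain ⟨P, hP, Q, hQ, hPQ⟩ := Filter.eventually_prod_iff.1 he
      obtain ⟨r, hr, hrQ⟩ := Metric.eventually_nhds_iff_ball.1 hQ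
      refine ⟨Metric.ball s r, Metric.ball_mem_nhds s hr, {x | P x}, hP, fun x hx => ?_⟩
      rw [Set.encard_le_one_iff]
      -- two zeros of `⟪x, γ⟫` would enclose a zero of its derivative
      have key : ∀ y w, y ∈ Metric.ball s r → w ∈ Metric.ball s r → y < w →
          inner ℝ x (γ y) = 0 → inner ℝ x (γ w) = 0 → False := by
        intro y w hy hw hyw hy0 hw0
        obtain ⟨c, hc, hc0⟩ := exists_hasDerivAt_eq_zero hyw
          (h.continuous_inner x).continuousOn (hy0.trans hw0.symm)
          fun u _ => h.hasDerivAt_inner x u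
        refine hPQ hx (hrQ c ?_) hc0
        rw [Real.ball_eq_Ioo] at hy hw ⊢
        exact ⟨hy.1.trans hc.1, hc.2.trans hw.2⟩
      rintro y w ⟨hy0, hy⟩ ⟨hw0, hw⟩
      rcases lt_trichotomy y w with hyw | hyw | hyw
      · exact (key y w hy hw hyw hy0 hw0).elim
      · exact hyw
      · exact (key w y hw hy hyw hw0 hy0).elim
    · have hc : Continuous fun p : E3 × ℝ => inner ℝ p.1 (γ p.2) :=
        continuous_fst.inner (h.contDiff.continuous.comp continuous_snd)
      have he : ∀ᶠ p : E3 × ℝ in 𝓝 (v, s), inner ℝ p.1 (γ p.2) ≠ 0 :=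
        (hc.tendsto (v, s)).eventually_ne hs
      rw [nhds_prod_eq] at he
      obtain ⟨P, hP, Q, hQ, hPQ⟩ := Filter.eventually_prod_iff.1 he
      refine ⟨{u | Q u}, hQ, {x | P x}, hP, fun x hx => ?_⟩
      rw [nonpos_iff_eq_zero, Set.encard_eq_zero, Set.eq_empty_iff_forall_notMem]
      rintro u ⟨hu0, hu⟩
      exact hPQ hx hu hu0
  choose W hW U hU hWU using hloc
  obtain ⟨T, hTI, hT⟩ := (isCompact_Icc (a := a) (b := a + l)).elim_nhds_subcover W fun s _ => hW s
  have hbound : ∀ x ∈ ⋂ s ∈ T, U s,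
      orthCount γ l x ≤ (T.filter fun s => inner ℝ v (γ s) = 0).card := by
    intro x hx
    rw [h.orthCount_eq x a]
    refine (encard_inter_le_sum T (Set.Ico_subset_Icc_self.trans hT)).trans ?_
    refine (Finset.sum_le_sum fun s hs => hWU s x (Set.mem_iInter₂.1 hx s hs)).trans ?_
    rw [Finset.sum_ite, Finset.sum_const_zero, add_zero, Finset.sum_const]
    simp
  have hmem : (⋂ s ∈ T, U s) ∈ 𝓝 v := (Filter.biInter_finset_mem T).2 fun s _ => hU s
  have hle : ((T.filter fun s => inner ℝ v (γ s) = 0).card : ℕ∞) ≤ orthCount γ l v := by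
    rw [h.orthCount_eq v a, ← Set.encard_coe_eq_coe_finsetCard]
    refine Set.encard_le_encard fun s hs => ?_
    have hs := Finset.mem_filter.1 (Finset.mem_coe.1 hs)
    refine ⟨hs.2, (hTI s hs.1).1, lt_of_le_of_ne (hTI s hs.1).2 ?_⟩
    rintro rfl
    exact hal hs.2
  refine ⟨ne_top_of_le_ne_top (ENat.natCast_ne_top _) (hbound v (mem_of_mem_nhds hmem)), ?_⟩
  filter_upwards [hmem] with x hx using (hbound x hx).trans hle

/-- The count is constant around every direction at which all zeros are simple. -/
theorem eventually_orthCount_eq (h : IsSignPeriodic γ l) {v : E3}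
    (hv : ∀ s, inner ℝ v (γ s) = 0 → inner ℝ v (deriv γ s) ≠ 0) :
    ∀ᶠ x in 𝓝 v, orthCount γ l x = orthCount γ l v := by
  obtain ⟨hfin, hup⟩ := h.orthCount_upper hv
  by_cases hex : ∃ s₀, inner ℝ v (γ s₀) = 0
  · obtain ⟨s₀, hs₀⟩ := hex
    obtain ⟨Z, δ, hδ, -, hcard, hZ, -, hsum⟩ := h.exists_isolating hfin hs₀
    filter_upwards [hup, (Filter.eventually_all_finset Z).2 fun z hz =>
      h.eventually_one_le_encard hδ (hZ z hz).1 (hv z (hZ z hz).1)] with x hx hx1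
    refine hx.antisymm ?_
    rw [hcard]
    refine le_trans ?_ ((Finset.sum_le_sum hx1).trans (hsum x))
    simp
  · push Not at hex
    have h0 : orthCount γ l v = 0 := by
      rw [orthCount, Set.encard_eq_zero, Set.eq_empty_iff_forall_notMem]
      exact fun s hs => hex s hs.2
    filter_upwards [hup] with x hx
    rw [h0] at hx ⊢
    exact nonpos_iff_eq_zero.1 hx

/-- The count is not constant around `v` if `⟪v, γ⟫` has a degenerate zero that is a simple zero
of `⟪w, γ⟫` for some `w`: the counts at `v + ε w` and `v - ε w` add up to more than twice the
count at `v`. -/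
theorem not_eventually_orthCount_eq_of_degenerate (h : IsSignPeriodic γ l) {v w : E3} {s₀ : ℝ}
    (hfin : orthCount γ l v ≠ ⊤) (hv : inner ℝ v (γ s₀) = 0) (hv' : inner ℝ v (deriv γ s₀) = 0)
    (hw : inner ℝ w (γ s₀) = 0) (hw' : inner ℝ w (deriv γ s₀) ≠ 0) (c : ℕ∞) :
    ¬ ∀ᶠ x in 𝓝 v, orthCount γ l x = c := by
  classical
  intro hc
  obtain ⟨Z, δ, hδ, hs₀, hcard, hZ, hiso, hsum⟩ := h.exists_isolating hfin hv
  have hcv : orthCount γ l v = c := hc.self_of_nhds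
  have hne : ∀ z ∈ Z, inner ℝ v (γ (z - δ)) ≠ 0 ∧ inner ℝ v (γ (z + δ)) ≠ 0 := by
    intro z hz
    constructor <;> intro h0
    · have := hiso z hz (z - δ) ⟨le_rfl, by linarith⟩ h0; linarith
    · have := hiso z hz (z + δ) ⟨by linarith, le_rfl⟩ h0; linarith
  have hloc : ∀ z ∈ Z, ∀ᶠ ε : ℝ in 𝓝[>] 0, (2 + if z = s₀ then 1 else 0 : ℕ∞)
      ≤ ({s | inner ℝ v (γ s) + ε * inner ℝ w (γ s) = 0} ∩ Set.Ioo (z - δ) (z + δ)).encard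
        + ({s | inner ℝ v (γ s) - ε * inner ℝ w (γ s) = 0} ∩ Set.Ioo (z - δ) (z + δ)).encard := by
    intro z hz
    split_ifs with hzs
    · subst hzs
      have := eventually_three_le_encard_add (h.continuous_inner v) (h.continuous_inner w) hδ hv
        (hne z hz).2 (by simpa [hv'] using h.hasDerivAt_inner v z) hw (h.hasDerivAt_inner w z) hw'
      filter_upwards [this] with ε hε
      exact le_trans (by norm_num) hε
    · simpa using eventually_two_le_encard_add (h.continuous_inner v) (h.continuous_inner w) hδ
        (hZ z hz).1 (hne z hz).1 (hne z hz).2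
  obtain ⟨ε, hε, hp, hm⟩ := (((Filter.eventually_all_finset Z).2 hloc).and
    (((tendsto_add_smul v w 1).eventually hc).and
      ((tendsto_add_smul v w (-1)).eventually hc))).exists
  have hp' := hsum (v + (1 * ε) • w)
  have hm' := hsum (v + (-1 * ε) • w)
  rw [hp] at hp'
  rw [hm] at hm'
  have hle := Finset.sum_le_sum hε
  have e1 : {s | inner ℝ v (γ s) + ε * inner ℝ w (γ s) = 0}
      = {s | inner ℝ (v + (1 * ε) • w) (γ s) = 0} := by
    ext s; simp [inner_add_left, real_inner_smul_left]
  have e2 : {s | inner ℝ v (γ s) - ε * inner ℝ w (γ s) = 0}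
      = {s | inner ℝ (v + (-1 * ε) • w) (γ s) = 0} := by
    ext s; simp [inner_add_left, real_inner_smul_left, sub_eq_add_neg]
  rw [e1, e2, Finset.sum_add_distrib, Finset.sum_add_distrib, Finset.sum_ite_eq' Z s₀,
    if_pos hs₀, Finset.sum_const, nsmul_eq_mul] at hle
  have htot := hle.trans (add_le_add hp' hm')
  rw [← hcv, hcard] at htot
  have : Z.card * 2 + 1 ≤ Z.card + Z.card := by exact_mod_cast htot
  omega

/-- The count is not constant around `v` if one of the zeros of `⟪v, γ⟫` is a local extremum and
all others are simple: moving `v` so that the extremum crosses zero, one zero becomes two, while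
the others persist. -/
theorem not_eventually_orthCount_eq_of_extremum (h : IsSignPeriodic γ l) {v : E3} {s₀ k : ℝ}
    (hfin : orthCount γ l v ≠ ⊤) (hv : inner ℝ v (γ s₀) = 0) (hk : k ≠ 0)
    (hsgn : ∀ᶠ u in 𝓝 s₀, 0 ≤ k * inner ℝ v (γ u)) (hγ : γ s₀ ≠ 0)
    (hsimple : ∀ s, |s - s₀| < l → s ≠ s₀ → inner ℝ v (γ s) = 0 → inner ℝ v (deriv γ s) ≠ 0)
    (c : ℕ∞) : ¬ ∀ᶠ x in 𝓝 v, orthCount γ l x = c := by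
  classical
  intro hc
  obtain ⟨Z, δ, hδ, hs₀, hcard, hZ, hiso, hsum⟩ := h.exists_isolating hfin hv
  have hcv : orthCount γ l v = c := hc.self_of_nhds
  have hloc : ∀ z ∈ Z, ∀ᶠ ε : ℝ in 𝓝[>] 0, (1 + if z = s₀ then 1 else 0 : ℕ∞)
      ≤ ({s | inner ℝ (v + (-1 * ε) • (k • γ s₀)) (γ s) = 0} ∩ Set.Ioo (z - δ) (z + δ)).encard := by
    intro z hz
    split_ifs with hzs
    · subst hzs
      have := eventually_two_le_encard_sub (h.continuous_inner v)
        (h.continuous_inner (k • γ z)) hδ hv (hiso z hz) hsgn (by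
          rw [real_inner_smul_left, ← mul_assoc, real_inner_self_eq_norm_sq]
          have : 0 < ‖γ z‖ := norm_pos_iff.2 hγ
          have : 0 < k * k := mul_self_pos.2 hk
          positivity)
      filter_upwards [this] with ε hε
      have e2 : {s | inner ℝ v (γ s) - ε * inner ℝ (k • γ z) (γ s) = 0}
          = {s | inner ℝ (v + (-1 * ε) • (k • γ z)) (γ s) = 0} := by
        ext s; simp [inner_add_left, real_inner_smul_left, sub_eq_add_neg]
      rw [e2] at hε
      exact le_trans (by norm_num) hε
    · simpa using (tendsto_add_smul v (k • γ s₀) (-1)).eventually (h.eventually_one_le_encard hδ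
        (hZ z hz).1 (hsimple z (hZ z hz).2 hzs (hZ z hz).1))
  obtain ⟨ε, hε, hm⟩ := (((Filter.eventually_all_finset Z).2 hloc).and
    ((tendsto_add_smul v (k • γ s₀) (-1)).eventually hc)).exists
  have hle := (Finset.sum_le_sum hε).trans (hsum _)
  rw [hm, ← hcv, hcard, Finset.sum_add_distrib, Finset.sum_ite_eq' Z s₀, if_pos hs₀,
    Finset.sum_const, nsmul_eq_mul] at hle
  have : Z.card * 1 + 1 ≤ Z.card := by exact_mod_cast hle
  omega

end IsSignPeriodic

/-! ### The moving frame -/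

/-- Expansion of a vector in an orthonormal frame of `E3`. -/
theorem eq_add_of_orthonormal {a b c : E3} (ha : ‖a‖ = 1) (hb : ‖b‖ = 1) (hc : ‖c‖ = 1)
    (hab : inner ℝ a b = 0) (hac : inner ℝ a c = 0) (hbc : inner ℝ b c = 0) (x : E3) :
    x = inner ℝ a x • a + inner ℝ b x • b + inner ℝ c x • c := by
  have hon : Orthonormal ℝ ![a, b, c] := by
    refine ⟨fun i => by fin_cases i <;> simp [ha, hb, hc], fun i j hij => ?_⟩
    have hba := real_inner_comm a b ▸ hab
    have hca := real_inner_comm a c ▸ hac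
    have hcb := real_inner_comm b c ▸ hbc
    fin_cases i <;> fin_cases j <;> simp_all
  have hsp := hon.linearIndependent.span_eq_top_of_card_eq_finrank (by simp)
  have h := (OrthonormalBasis.mk hon hsp.ge).sum_repr' x
  rw [Fin.sum_univ_three] at h
  simpa using h.symm

theorem inner_cross3_left (x y : E3) : inner ℝ x (cross3 x y) = 0 := by
  simp [cross3, PiLp.inner_apply, Fin.sum_univ_three, cross_apply]; ring

theorem inner_cross3_right (x y : E3) : inner ℝ y (cross3 x y) = 0 := by
  simp [cross3, PiLp.inner_apply, Fin.sum_univ_three, cross_apply]; ring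

theorem norm_cross3_sq (x y : E3) : ‖cross3 x y‖ ^ 2 = ‖x‖ ^ 2 * ‖y‖ ^ 2 - inner ℝ x y ^ 2 := by
  simp only [EuclideanSpace.real_norm_sq_eq]
  simp [cross3, PiLp.inner_apply, Fin.sum_univ_three, cross_apply]; ring

theorem cross3_smul_left (c : ℝ) (x y : E3) : cross3 (c • x) y = c • cross3 x y := by
  ext i; simp [cross3]

theorem inner_deriv_add_inner_deriv {x y : ℝ → E3} (hx : ContDiff ℝ ∞ x) (hy : ContDiff ℝ ∞ y)
    {c : ℝ} (h : ∀ s, inner ℝ (x s) (y s) = c) (s : ℝ) :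
    inner ℝ (x s) (deriv y s) + inner ℝ (deriv x s) (y s) = 0 := by
  have hd := ((hx.differentiable (by simp)) s).hasDerivAt.inner ℝ
    ((hy.differentiable (by simp)) s).hasDerivAt
  rw [show (fun t => inner ℝ (x t) (y t)) = fun _ => c from funext h] at hd
  exact hd.unique (hasDerivAt_const s c)

theorem contDiff_deriv {x : ℝ → E3} (hx : ContDiff ℝ ∞ x) : ContDiff ℝ ∞ (deriv x) :=
  (contDiff_infty_iff_deriv.1 hx).2

theorem inner_deriv_self_of_norm {x : ℝ → E3} (hx : ContDiff ℝ ∞ x) (h : ∀ s, ‖x s‖ = 1) (s : ℝ) :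
    inner ℝ (x s) (deriv x s) = 0 := by
  have := inner_deriv_add_inner_deriv hx hx (c := 1)
    (fun s => by rw [real_inner_self_eq_norm_sq, h s]; norm_num) s
  rw [real_inner_comm (x s) (deriv x s)] at this
  linarith

theorem periodic_deriv {x : ℝ → E3} {l : ℝ} (h : Function.Periodic x l) :
    Function.Periodic (deriv x) l := by
  intro s
  rw [← deriv_comp_add_const, show (fun u => x (u + l)) = x from funext h]

namespace SmoothKnot

variable (K : SmoothKnot)

theorem contDiff_t : ContDiff ℝ ∞ K.t := contDiff_deriv K.r_smooth

theorem norm_t (s : ℝ) : ‖K.t s‖ = 1 := K.r_unit_speed s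

theorem inner_b_t (s : ℝ) : inner ℝ (K.b s) (K.t s) = 0 := K.b_orth_velocity s

theorem inner_b_n (s : ℝ) : inner ℝ (K.b s) (K.n s) = 0 := inner_cross3_left _ _

theorem inner_t_n (s : ℝ) : inner ℝ (K.t s) (K.n s) = 0 := inner_cross3_right _ _

theorem norm_n (s : ℝ) : ‖K.n s‖ = 1 := by
  have h : ‖K.n s‖ ^ 2 = 1 := by simp [n, norm_cross3_sq, K.b_unit, K.norm_t, K.inner_b_t]
  exact (pow_eq_one_iff_of_nonneg (norm_nonneg _) two_ne_zero).1 h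

theorem contDiff_n : ContDiff ℝ ∞ K.n := by
  have ht := contDiff_euclidean.1 K.contDiff_t
  have hb := contDiff_euclidean.1 K.b_smooth
  refine contDiff_euclidean.2 fun i => ?_
  fin_cases i <;> simp [n, cross3, cross_apply] <;>
    exact ((hb _).mul (ht _)).sub ((hb _).mul (ht _))

theorem expand_btn (s : ℝ) (x : E3) :
    x = inner ℝ (K.b s) x • K.b s + inner ℝ (K.t s) x • K.t s + inner ℝ (K.n s) x • K.n s :=
  eq_add_of_orthonormal (K.b_unit s) (K.norm_t s) (K.norm_n s) (K.inner_b_t s) (K.inner_b_n s)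
    (K.inner_t_n s) x

theorem deriv_t (s : ℝ) : deriv K.t s = K.curvature s • K.n s := by
  have h1 : inner ℝ (K.b s) (deriv K.t s) = 0 := K.b_orth_acceleration s
  have h2 := inner_deriv_self_of_norm K.contDiff_t K.norm_t s
  have h := K.expand_btn s (deriv K.t s)
  rw [h1, h2, zero_smul, zero_smul, zero_add, zero_add, real_inner_comm] at h
  exact h

theorem deriv_b (s : ℝ) : deriv K.b s = - K.torsion s • K.n s := by
  have h1 := inner_deriv_self_of_norm K.b_smooth K.b_unit s
  have h2 := inner_deriv_add_inner_deriv K.contDiff_t K.b_smooth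
    (fun s => by rw [real_inner_comm, K.inner_b_t s]) s
  rw [K.deriv_t s, real_inner_smul_left, real_inner_comm (K.b s), K.inner_b_n, mul_zero,
    add_zero] at h2
  have h := K.expand_btn s (deriv K.b s)
  rw [h1, h2, zero_smul, zero_smul, zero_add, zero_add, real_inner_comm] at h
  rw [torsion, neg_neg]
  exact h

theorem deriv_n (s : ℝ) : deriv K.n s = K.torsion s • K.b s - K.curvature s • K.t s := by
  have h1 := inner_deriv_self_of_norm K.contDiff_n K.norm_n s
  have h2 := inner_deriv_add_inner_deriv K.contDiff_t K.contDiff_n K.inner_t_n s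
  have h3 := inner_deriv_add_inner_deriv K.b_smooth K.contDiff_n K.inner_b_n s
  rw [K.deriv_t s, real_inner_smul_left, real_inner_self_eq_norm_sq, K.norm_n] at h2
  rw [K.deriv_b s, real_inner_smul_left, real_inner_self_eq_norm_sq, K.norm_n] at h3
  have h := K.expand_btn s (deriv K.n s)
  rw [h1, show inner ℝ (K.b s) (deriv K.n s) = K.torsion s by linarith,
    show inner ℝ (K.t s) (deriv K.n s) = - K.curvature s by linarith] at h
  rw [h]; module

theorem contDiff_curvature : ContDiff ℝ ∞ K.curvature :=
  (contDiff_deriv K.contDiff_t).inner ℝ K.contDiff_n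

theorem contDiff_torsion : ContDiff ℝ ∞ K.torsion :=
  ((contDiff_deriv K.b_smooth).inner ℝ K.contDiff_n).neg

theorem sq_add_sq_pos (s : ℝ) : 0 < K.curvature s ^ 2 + K.torsion s ^ 2 := by
  by_contra! h
  have h1 : K.curvature s = 0 := by nlinarith [sq_nonneg (K.curvature s), sq_nonneg (K.torsion s)]
  have h2 : K.torsion s = 0 := by nlinarith [sq_nonneg (K.curvature s), sq_nonneg (K.torsion s)]
  refine K.not_both_zero s ⟨?_, by rw [K.deriv_b, h2]; simp⟩
  change deriv K.t s = 0
  rw [K.deriv_t, h1, zero_smul]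

theorem angularVelocity_pos (s : ℝ) : 0 < K.angularVelocity s := Real.sqrt_pos.2 (K.sq_add_sq_pos s)

theorem angularVelocity_sq (s : ℝ) :
    K.angularVelocity s ^ 2 = K.curvature s ^ 2 + K.torsion s ^ 2 :=
  Real.sq_sqrt (K.sq_add_sq_pos s).le

theorem contDiff_angularVelocity : ContDiff ℝ ∞ K.angularVelocity :=
  ((K.contDiff_curvature.pow 2).add (K.contDiff_torsion.pow 2)).sqrt fun s => (K.sq_add_sq_pos s).ne'

/-- The unit tangent vector of the notrix. Together with `n` and `d` it forms an orthonormal frame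
in which the notrix and the Darboux indicatrix both move along `e`. -/
def e (s : ℝ) : E3 :=
  (K.angularVelocity s)⁻¹ • (K.torsion s • K.b s - K.curvature s • K.t s)

/-- The signed speed of the Darboux indicatrix, `d' = λ e`. -/
def darbouxSpeed (s : ℝ) : ℝ := inner ℝ (K.e s) (deriv K.d s)

theorem contDiff_inv_angularVelocity : ContDiff ℝ ∞ fun s => (K.angularVelocity s)⁻¹ :=
  K.contDiff_angularVelocity.inv fun s => (K.angularVelocity_pos s).ne'

theorem contDiff_e : ContDiff ℝ ∞ K.e :=
  K.contDiff_inv_angularVelocity.smul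
    ((K.contDiff_torsion.smul K.b_smooth).sub (K.contDiff_curvature.smul K.contDiff_t))

theorem contDiff_d : ContDiff ℝ ∞ K.d :=
  K.contDiff_inv_angularVelocity.smul
    ((K.contDiff_curvature.smul K.b_smooth).add (K.contDiff_torsion.smul K.contDiff_t))

theorem continuous_darbouxSpeed : Continuous K.darbouxSpeed :=
  K.contDiff_e.continuous.inner (contDiff_deriv K.contDiff_d).continuous

theorem inner_t_b (s : ℝ) : inner ℝ (K.t s) (K.b s) = 0 := by rw [real_inner_comm, K.inner_b_t]

theorem inner_n_b (s : ℝ) : inner ℝ (K.n s) (K.b s) = 0 := by rw [real_inner_comm, K.inner_b_n]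

theorem inner_n_t (s : ℝ) : inner ℝ (K.n s) (K.t s) = 0 := by rw [real_inner_comm, K.inner_t_n]

theorem inner_n_e (s : ℝ) : inner ℝ (K.n s) (K.e s) = 0 := by
  simp [e, real_inner_smul_right, inner_sub_right, K.inner_n_b, K.inner_n_t]

theorem inner_n_d (s : ℝ) : inner ℝ (K.n s) (K.d s) = 0 := by
  simp [d, real_inner_smul_right, inner_add_right, K.inner_n_b, K.inner_n_t]

theorem inner_e_d (s : ℝ) : inner ℝ (K.e s) (K.d s) = 0 := by
  simp only [e, d, real_inner_smul_right, real_inner_smul_left, inner_add_right, inner_sub_left,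
    real_inner_self_eq_norm_sq, K.b_unit, K.norm_t, K.inner_b_t, K.inner_t_b]
  ring

theorem norm_e (s : ℝ) : ‖K.e s‖ = 1 := by
  have h : ‖K.e s‖ ^ 2 = 1 := by
    rw [← real_inner_self_eq_norm_sq]
    simp only [e, real_inner_smul_right, real_inner_smul_left, inner_sub_right, inner_sub_left]
    simp only [real_inner_self_eq_norm_sq, K.b_unit, K.norm_t, K.inner_b_t, K.inner_t_b]
    have := K.angularVelocity_sq s
    have := (K.angularVelocity_pos s).ne'
    field_simp
    linarith
  exact (pow_eq_one_iff_of_nonneg (norm_nonneg _) two_ne_zero).1 h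

theorem norm_d (s : ℝ) : ‖K.d s‖ = 1 := by
  have h : ‖K.d s‖ ^ 2 = 1 := by
    rw [← real_inner_self_eq_norm_sq]
    simp only [d, real_inner_smul_right, real_inner_smul_left, inner_add_right, inner_add_left]
    simp only [real_inner_self_eq_norm_sq, K.b_unit, K.norm_t, K.inner_b_t, K.inner_t_b]
    have := K.angularVelocity_sq s
    have := (K.angularVelocity_pos s).ne'
    field_simp
    linarith
  exact (pow_eq_one_iff_of_nonneg (norm_nonneg _) two_ne_zero).1 h

theorem expand_ned (s : ℝ) (x : E3) :
    x = inner ℝ (K.n s) x • K.n s + inner ℝ (K.e s) x • K.e s + inner ℝ (K.d s) x • K.d s :=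
  eq_add_of_orthonormal (K.norm_n s) (K.norm_e s) (K.norm_d s) (K.inner_n_e s) (K.inner_n_d s)
    (K.inner_e_d s) x

theorem deriv_n_eq_smul_e (s : ℝ) : deriv K.n s = K.angularVelocity s • K.e s := by
  rw [K.deriv_n, e, smul_smul, mul_inv_cancel₀ (K.angularVelocity_pos s).ne', one_smul]

theorem deriv_d (s : ℝ) : deriv K.d s = K.darbouxSpeed s • K.e s := by
  have h1 := inner_deriv_self_of_norm K.contDiff_d K.norm_d s
  have h2 := inner_deriv_add_inner_deriv K.contDiff_n K.contDiff_d K.inner_n_d s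
  rw [K.deriv_n_eq_smul_e, real_inner_smul_left, K.inner_e_d, mul_zero, add_zero] at h2
  have h := K.expand_ned s (deriv K.d s)
  rw [h1, h2, zero_smul, zero_smul, zero_add, add_zero] at h
  exact h

theorem inner_n_deriv_e (s : ℝ) : inner ℝ (K.n s) (deriv K.e s) = - K.angularVelocity s := by
  have h := inner_deriv_add_inner_deriv K.contDiff_n K.contDiff_e K.inner_n_e s
  rw [K.deriv_n_eq_smul_e, real_inner_smul_left, real_inner_self_eq_norm_sq, K.norm_e] at h
  linarith

/-- Obtained by differentiating `ω d = κ b + τ t` and comparing the components along `e`. -/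
theorem angularVelocity_sq_mul_darbouxSpeed (s : ℝ) :
    K.angularVelocity s ^ 2 * K.darbouxSpeed s
      = deriv K.curvature s * K.torsion s - deriv K.torsion s * K.curvature s := by
  have hω := ((K.contDiff_angularVelocity.differentiable (by simp)) s).hasDerivAt
  have hκ := ((K.contDiff_curvature.differentiable (by simp)) s).hasDerivAt
  have hτ := ((K.contDiff_torsion.differentiable (by simp)) s).hasDerivAt
  have hd := ((K.contDiff_d.differentiable (by simp)) s).hasDerivAt
  have hb := ((K.b_smooth.differentiable (by simp)) s).hasDerivAt
  have ht := ((K.contDiff_t.differentiable (by simp)) s).hasDerivAt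
  have h1 := hω.smul hd
  have h2 := (hκ.smul hb).add (hτ.smul ht)
  have heq : K.angularVelocity • K.d = K.curvature • K.b + K.torsion • K.t := by
    funext u
    simp only [Pi.smul_apply', Pi.add_apply]
    rw [d, smul_smul, mul_inv_cancel₀ (K.angularVelocity_pos u).ne', one_smul]
  have h3 := congrArg (fun x => inner ℝ (K.e s) x) (h1.unique (heq ▸ h2))
  rw [K.deriv_b, K.deriv_t, K.deriv_d] at h3
  have h5 : inner ℝ (K.e s) (K.b s) = (K.angularVelocity s)⁻¹ * K.torsion s := by
    simp [e, real_inner_smul_left, inner_sub_left, K.b_unit, K.inner_t_b]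
  have h6 : inner ℝ (K.e s) (K.t s) = - ((K.angularVelocity s)⁻¹ * K.curvature s) := by
    simp [e, real_inner_smul_left, inner_sub_left, K.norm_t, K.inner_b_t]
  have h7 : inner ℝ (K.e s) (K.n s) = 0 := by rw [real_inner_comm, K.inner_n_e]
  simp only [inner_add_right, real_inner_smul_right, real_inner_self_eq_norm_sq, K.norm_e,
    K.inner_e_d, h5, h6, h7] at h3
  have := (K.angularVelocity_pos s).ne'
  field_simp at h3
  linarith

theorem geodesicCurvatureStationaryAt_iff (s : ℝ) :
    K.GeodesicCurvatureStationaryAt s ↔ K.darbouxSpeed s = 0 := by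
  have hκ := ((K.contDiff_curvature.differentiable (by simp)) s).hasDerivAt
  have hτ := ((K.contDiff_torsion.differentiable (by simp)) s).hasDerivAt
  have h := K.angularVelocity_sq_mul_darbouxSpeed s
  have hω := (pow_pos (K.angularVelocity_pos s) 2).ne'
  have h0 : K.darbouxSpeed s = 0 ↔
      deriv K.curvature s * K.torsion s - deriv K.torsion s * K.curvature s = 0 := by
    rw [← h, mul_eq_zero, or_iff_right hω]
  rw [h0, GeodesicCurvatureStationaryAt]
  by_cases hk : K.curvature s = 0
  · have ht : K.torsion s ≠ 0 := by
      intro ht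
      have := K.sq_add_sq_pos s
      simp [hk, ht] at this
    have h1 := (hκ.fun_div hτ ht).deriv
    simp only [hk, ne_eq, not_true_eq_false, false_and, true_and, false_or, h1]
    simp [ht]
  · have h1 := (hτ.fun_div hκ hk).deriv
    simp only [hk, ne_eq, not_false_eq_true, true_and, false_and, or_false, h1,
      div_eq_zero_iff, pow_eq_zero_iff, two_ne_zero]
    constructor <;> intro h <;> linarith

/-! ### Periodicity of the frame -/

theorem periodic_t : Function.Periodic K.t K.l := periodic_deriv K.r_periodic

theorem periodic_deriv_t : Function.Periodic (deriv K.t) K.l := periodic_deriv K.periodic_t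

theorem countable_deriv_t_eq_zero : {s | deriv K.t s = 0}.Countable := by
  refine (Set.countable_iUnion fun k : ℤ =>
    (K.finite_t.countable.image fun u => u + k • K.l)).mono ?_
  intro s hs
  refine Set.mem_iUnion.2 ⟨toIcoDiv K.l_pos 0 s, toIcoMod K.l_pos 0 s, ⟨?_, ?_⟩, ?_⟩
  · simpa using toIcoMod_mem_Ico K.l_pos 0 s
  · change deriv K.t _ = 0
    exact (K.periodic_deriv_t.sub_zsmul_eq _).trans hs
  · exact toIcoMod_add_toIcoDiv_zsmul K.l_pos 0 s

/-- On going once around the knot, `b` returns to itself up to a sign: where `t'` does not vanish,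
`b` is determined up to a sign by `t` and `t'`, and the points where `t'` vanishes are isolated. -/
theorem exists_b_add_eq : ∃ σ : ℝ, σ ^ 2 = 1 ∧ ∀ s, K.b (s + K.l) = σ • K.b s := by
  have hcont : Continuous fun s => inner ℝ (K.b s) (K.b (s + K.l)) :=
    K.b_smooth.continuous.inner (K.b_smooth.continuous.comp (continuous_add_const K.l))
  have hnorm : ∀ x y : E3, ‖x‖ = 1 → ∀ c : ℝ, y = c • x → ‖y‖ = 1 → c ^ 2 = 1 := by
    rintro x y hx c rfl hy
    rw [norm_smul, hx, mul_one, Real.norm_eq_abs] at hy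
    rw [← sq_abs, hy, one_pow]
  have hgen : ∀ s, deriv K.t s ≠ 0 → inner ℝ (K.b s) (K.b (s + K.l)) ^ 2 = 1 := by
    intro s hs
    have h1 : inner ℝ (K.t s) (K.b (s + K.l)) = 0 := by
      rw [← K.periodic_t s, K.inner_t_b]
    have h2 : inner ℝ (K.n s) (K.b (s + K.l)) = 0 := by
      have h3 : inner ℝ (deriv K.t s) (K.b (s + K.l)) = 0 := by
        rw [← K.periodic_deriv_t s, real_inner_comm]
        exact K.b_orth_acceleration _
      rw [K.deriv_t, real_inner_smul_left] at h3
      refine (mul_eq_zero.1 h3).resolve_left fun h0 => hs ?_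
      rw [K.deriv_t, h0, zero_smul]
    have h := K.expand_btn s (K.b (s + K.l))
    rw [h1, h2, zero_smul, zero_smul, add_zero, add_zero] at h
    exact hnorm _ _ (K.b_unit s) _ h (K.b_unit _)
  have hsq : ∀ s, inner ℝ (K.b s) (K.b (s + K.l)) ^ 2 = 1 := by
    have hcl : IsClosed {s | inner ℝ (K.b s) (K.b (s + K.l)) ^ 2 = 1} :=
      isClosed_eq (hcont.pow 2) continuous_const
    have hd : Dense {s | deriv K.t s = 0}ᶜ := K.countable_deriv_t_eq_zero.dense_compl ℝ
    intro s
    have := (hcl.closure_subset_iff.2 fun s hs => hgen s hs) (hd s)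
    exact this
  have hdet : ∀ s, K.b (s + K.l) = inner ℝ (K.b s) (K.b (s + K.l)) • K.b s := by
    intro s
    rw [← sub_eq_zero, ← norm_eq_zero, ← sq_eq_zero_iff, norm_sub_sq_real, norm_smul,
      real_inner_smul_right, K.b_unit, K.b_unit, real_inner_comm (K.b s), mul_one,
      Real.norm_eq_abs, sq_abs, ← sq, hsq s]
    norm_num
  rcases isPreconnected_univ.eq_one_or_eq_neg_one_of_sq_eq hcont.continuousOn
    (fun s _ => hsq s) with h | h
  · exact ⟨1, by norm_num, fun s => by
      rw [hdet s]; exact congrArg (· • K.b s) (h (Set.mem_univ s))⟩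
  · exact ⟨-1, by norm_num, fun s => by
      rw [hdet s]; exact congrArg (· • K.b s) (h (Set.mem_univ s))⟩

theorem exists_n_e_add_eq : ∃ σ : ℝ, σ ^ 2 = 1 ∧ (∀ s, K.n (s + K.l) = σ • K.n s) ∧
    (∀ s, K.e (s + K.l) = σ • K.e s) ∧ ∀ s, K.d (s + K.l) = K.d s := by
  obtain ⟨σ, hσ, hb⟩ := K.exists_b_add_eq
  have hn : ∀ s, K.n (s + K.l) = σ • K.n s := by
    intro s; rw [n, hb, K.periodic_t, cross3_smul_left, ← n]
  have hκ : ∀ s, K.curvature (s + K.l) = σ * K.curvature s := by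
    intro s; rw [curvature, K.periodic_deriv_t, hn, real_inner_smul_right, ← curvature]
  have hb' : ∀ s, deriv K.b (s + K.l) = σ • deriv K.b s := by
    intro s
    rw [← deriv_comp_add_const, show (fun u => K.b (u + K.l)) = fun u => σ • K.b u from funext hb,
      deriv_fun_const_smul_field]
  have hτ : ∀ s, K.torsion (s + K.l) = K.torsion s := by
    intro s
    rw [torsion, hb', hn, real_inner_smul_right, real_inner_smul_left, ← mul_assoc, ← sq, hσ,
      one_mul, ← torsion]
  have hω : ∀ s, K.angularVelocity (s + K.l) = K.angularVelocity s := by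
    intro s; rw [angularVelocity, hκ, hτ, mul_pow, hσ, one_mul, ← angularVelocity]
  refine ⟨σ, hσ, hn, fun s => ?_, fun s => ?_⟩
  · rw [e, hω, hτ, hκ, hb, K.periodic_t, e]; module
  · have : (σ * K.curvature s) • σ • K.b s = K.curvature s • K.b s := by
      rw [smul_smul, mul_right_comm, ← sq, hσ, one_mul]
    rw [d, hω, hτ, hκ, hb, K.periodic_t, d, this]

theorem periodic_d : Function.Periodic K.d K.l := by
  obtain ⟨σ, -, -, -, h⟩ := K.exists_n_e_add_eq
  exact h

theorem isSignPeriodic_n : IsSignPeriodic K.n K.l where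
  pos := K.l_pos
  contDiff := K.contDiff_n.of_le (by norm_cast)
  add_eq := by
    obtain ⟨σ, hσ, hn, -, -⟩ := K.exists_n_e_add_eq
    intro s
    rcases sq_eq_one_iff.1 hσ with rfl | rfl <;> simp [hn]

theorem isSignPeriodic_d : IsSignPeriodic K.d K.l where
  pos := K.l_pos
  contDiff := K.contDiff_d.of_le (by norm_cast)
  add_eq s := .inl (K.periodic_d s)

end SmoothKnot

/-! ### Tests for local constancy -/

/-- Zero counts do not depend on the length of the vector, so constancy near a point can be tested
in the sphere or in the ambient space. -/
theorem mem_sphereMapGraph_iff {γ : ℝ → E3} {l : ℝ} {f : S2 → ℕ∞}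
    (hf : ∀ q : S2, f q = orthCount γ l q) (p : S2) :
    p ∈ sphereMapGraph f ↔ ∀ c, ¬ ∀ᶠ x in 𝓝 (p : E3), orthCount γ l x = c := by
  have hp : ‖(p : E3)‖ = 1 := by simp
  rw [sphereMapGraph, Set.mem_ofPred_eq, ← not_exists, not_iff_not]
  constructor
  · rintro ⟨U, hU, hpU, c, hc⟩
    obtain ⟨V, hV, rfl⟩ := isOpen_induced_iff.1 hU
    refine ⟨c, ?_⟩
    have hp0 : (p : E3) ≠ 0 := norm_ne_zero_iff.1 (by rw [hp]; exact one_ne_zero)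
    have hcont : ContinuousAt (fun x : E3 => ‖x‖⁻¹ • x) p :=
      (continuous_norm.continuousAt.inv₀ (by rw [hp]; exact one_ne_zero)).smul continuousAt_id
    have hVp : V ∈ 𝓝 (‖(p : E3)‖⁻¹ • (p : E3)) := by
      rw [hp, inv_one, one_smul]; exact hV.mem_nhds hpU
    filter_upwards [hcont.eventually_mem hVp, isOpen_ne.mem_nhds hp0] with x hx hx0
    have hx0 : x ≠ 0 := hx0
    have hn : ‖‖x‖⁻¹ • x‖ = 1 := by
      rw [norm_smul, norm_inv, norm_norm, inv_mul_cancel₀ (norm_ne_zero_iff.2 hx0)]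
    have := hc ⟨‖x‖⁻¹ • x, by simpa using hn⟩ hx
    rwa [hf, IsSignPeriodic.orthCount_smul (inv_ne_zero (norm_ne_zero_iff.2 hx0))] at this
  · rintro ⟨c, hc⟩
    obtain ⟨V, hVc, hV, hpV⟩ := eventually_nhds_iff.1 hc
    exact ⟨Subtype.val ⁻¹' V, hV.preimage continuous_subtype_val, hpV, c,
      fun q hq => (hf q).trans (hVc q hq)⟩

theorem finite_of_eventually_not {P : ℝ → Prop} (a b : ℝ)
    (h : ∀ s, ∀ᶠ u in 𝓝[≠] s, ¬ P u) : {s ∈ Set.Icc a b | P s}.Finite := by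
  by_contra hinf
  obtain ⟨x, -, hx⟩ := Set.Infinite.exists_accPt_of_subset_isCompact hinf
    (isCompact_Icc (a := a) (b := b)) fun s hs => hs.1
  rw [accPt_iff_frequently_nhdsNE] at hx
  exact hx ((h x).mono fun u hu hu' => hu hu'.2)

/-- A function whose derivative does not vanish near a point, except possibly at this point, takes
its value at the point nowhere else nearby. -/
theorem eventually_ne_of_deriv_ne {f f' : ℝ → ℝ} (hf : ∀ u, HasDerivAt f (f' u) u) {s : ℝ}
    (h : ∀ᶠ u in 𝓝[≠] s, f' u ≠ 0) : ∀ᶠ u in 𝓝[≠] s, f u ≠ f s := by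
  rw [eventually_nhdsWithin_iff] at h ⊢
  obtain ⟨r, hr, hball⟩ := Metric.eventually_nhds_iff_ball.1 h
  filter_upwards [Metric.ball_mem_nhds s hr] with u hu hne heq
  rw [Real.ball_eq_Ioo] at hu hball
  have hc : Continuous f := continuous_iff_continuousAt.2 fun u => (hf u).continuousAt
  rcases lt_or_gt_of_ne (show u ≠ s from hne) with hus | hus
  · obtain ⟨c, hc, hc0⟩ := exists_hasDerivAt_eq_zero hus hc.continuousOn heq fun u _ => hf u
    exact hball c ⟨hu.1.trans hc.1, by linarith [hc.2]⟩ hc.2.ne hc0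
  · obtain ⟨c, hc, hc0⟩ := exists_hasDerivAt_eq_zero hus hc.continuousOn heq.symm fun u _ => hf u
    exact hball c ⟨by linarith [hc.1], hc.2.trans hu.2⟩ hc.1.ne' hc0

/-- A function whose derivative changes from nonpositive to nonnegative at a zero of the function is
nonnegative around this zero. -/
theorem eventually_nonneg_of_deriv {f f' : ℝ → ℝ} (hf : ∀ u, HasDerivAt f (f' u) u) {s : ℝ}
    (hs : f s = 0) (h : ∀ᶠ u in 𝓝[≠] s, 0 ≤ f' u * (u - s)) : ∀ᶠ u in 𝓝 s, 0 ≤ f u := by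
  rw [eventually_nhdsWithin_iff] at h
  obtain ⟨r, hr, hball⟩ := Metric.eventually_nhds_iff_ball.1 h
  filter_upwards [Metric.ball_mem_nhds s hr] with u hu
  rw [Real.ball_eq_Ioo] at hu hball
  have hc : Continuous f := continuous_iff_continuousAt.2 fun u => (hf u).continuousAt
  rcases lt_trichotomy u s with hus | hus | hus
  · obtain ⟨c, hc, hc0⟩ := exists_hasDerivAt_eq_slope f f' hus hc.continuousOn fun u _ => hf u
    have h1 := hball c ⟨hu.1.trans hc.1, by linarith [hc.2]⟩ hc.2.ne
    rw [eq_div_iff (by linarith), hs] at hc0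
    nlinarith [hc.1, hc.2, nonpos_of_mul_nonneg_left h1 (by linarith [hc.2])]
  · rw [hus, hs]
  · obtain ⟨c, hc, hc0⟩ := exists_hasDerivAt_eq_slope f f' hus hc.continuousOn fun u _ => hf u
    have h1 := hball c ⟨by linarith [hc.1], hc.2.trans hu.2⟩ hc.1.ne'
    rw [eq_div_iff (by linarith), hs] at hc0
    have h2 : 0 ≤ f' c := nonneg_of_mul_nonneg_left h1 (by linarith [hc.1])
    nlinarith [mul_nonneg h2 (show 0 ≤ u - s by linarith)]

theorem eventually_quadratic_ne {a b c : ℝ} (h : b ≠ 0 ∨ c ≠ 0) :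
    ∀ᶠ x : ℝ in 𝓝[≠] 0, a + x * b + x ^ 2 * c ≠ 0 := by
  by_cases ha : a = 0
  · by_cases hb : b = 0
    · filter_upwards [self_mem_nhdsWithin] with x hx
      have hc := h.resolve_left (not_not.2 hb)
      have hx : x ≠ 0 := hx
      simp [ha, hb, hc, hx]
    · have hc : Continuous fun x : ℝ => b + x * c := by fun_prop
      have h1 : ∀ᶠ x : ℝ in 𝓝 0, b + x * c ≠ 0 :=
        (hc.tendsto 0).eventually_ne (by simpa using hb)
      filter_upwards [self_mem_nhdsWithin, h1.filter_mono nhdsWithin_le_nhds] with x hx hx1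
      have : a + x * b + x ^ 2 * c = x * (b + x * c) := by rw [ha]; ring
      rw [this]
      exact mul_ne_zero hx hx1
  · have hc : Continuous fun x : ℝ => a + x * b + x ^ 2 * c := by fun_prop
    have h1 : ∀ᶠ x : ℝ in 𝓝 0, a + x * b + x ^ 2 * c ≠ 0 :=
      (hc.tendsto 0).eventually_ne (by simpa using ha)
    exact h1.filter_mono nhdsWithin_le_nhds

theorem eq_or_eq_neg_of_eq_smul {v w : E3} {c : ℝ} (hv : ‖v‖ = 1) (hw : ‖w‖ = 1)
    (h : v = c • w) : v = w ∨ v = - w := by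
  have hc : |c| = 1 := by
    rw [h, norm_smul, hw, mul_one, Real.norm_eq_abs] at hv; exact hv
  rcases eq_or_eq_neg_of_abs_eq hc with rfl | rfl
  · left; simpa using h
  · right; simpa using h

theorem deriv_continuousLinearMap_apply (L : E3 →L[ℝ] E3) {x : ℝ → E3} (hx : ContDiff ℝ ∞ x) :
    deriv (fun u => L (x u)) = fun u => L (deriv x u) := by
  funext u
  exact (L.hasFDerivAt.comp_hasDerivAt u
    ((hx.differentiable (by simp)) u).hasDerivAt).deriv

theorem starProjection_orthogonal_eq_zero_iff (v x : E3) :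
    (Submodule.span ℝ {v})ᗮ.starProjection x = 0 ↔ x ∈ Submodule.span ℝ {v} := by
  rw [Submodule.starProjection_apply_eq_zero_iff, Submodule.orthogonal_orthogonal]

namespace SmoothKnot

variable (K : SmoothKnot)

theorem eq_smul_d {v : E3} {s : ℝ} (h1 : inner ℝ v (K.n s) = 0) (h2 : inner ℝ v (K.e s) = 0) :
    v = inner ℝ (K.d s) v • K.d s := by
  have h := K.expand_ned s v
  rwa [real_inner_comm, h1, real_inner_comm, h2, zero_smul, zero_smul, zero_add, zero_add] at h

theorem eq_smul_n {v : E3} {s : ℝ} (h1 : inner ℝ v (K.d s) = 0) (h2 : inner ℝ v (K.e s) = 0) :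
    v = inner ℝ (K.n s) v • K.n s := by
  have h := K.expand_ned s v
  rwa [real_inner_comm v (K.d s), h1, real_inner_comm v (K.e s), h2, zero_smul, zero_smul, add_zero,
    add_zero] at h

/-! ### The two maps as counts of orthogonal parameters -/

theorem deriv_t_eq_zero_iff (s : ℝ) : deriv K.t s = 0 ↔ K.curvature s = 0 := by
  rw [K.deriv_t, smul_eq_zero, or_iff_left]
  intro h
  simpa [h] using K.norm_n s

theorem isTantrixStationary_iff (v : E3) (s : ℝ) :
    K.IsTantrixStationary v s ↔ inner ℝ v (K.n s) = 0 := by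
  have h : deriv (fun u => inner ℝ v (K.t u)) s = K.curvature s * inner ℝ v (K.n s) := by
    have h1 := (hasDerivAt_const s v).inner ℝ
      ((K.contDiff_t.differentiable (by simp)) s).hasDerivAt
    rw [h1.deriv, K.deriv_t, real_inner_smul_right, inner_zero_left, add_zero]
  rw [IsTantrixStationary, h, ne_eq, K.deriv_t_eq_zero_iff]
  by_cases hk : K.curvature s = 0 <;> simp [hk]

theorem deriv_deriv_t (s : ℝ) : deriv (deriv K.t) s
    = deriv K.curvature s • K.n s + (K.curvature s * K.angularVelocity s) • K.e s := by
  have h1 : deriv K.t = fun u => K.curvature u • K.n u := funext K.deriv_t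
  have h2 := ((K.contDiff_curvature.differentiable (by simp)) s).hasDerivAt.fun_smul
    ((K.contDiff_n.differentiable (by simp)) s).hasDerivAt
  rw [h1, h2.deriv, K.deriv_n_eq_smul_e, smul_smul, add_comm]

/-- The velocity and the acceleration of the tantrix span the plane orthogonal to `d` (where
`κ ≠ 0`), and their projections are dependent exactly if this plane contains `v`. -/
theorem isTantrixInflection_iff {v : E3} (hv : v ≠ 0) (s : ℝ) :
    K.IsTantrixInflection v s ↔ inner ℝ v (K.d s) = 0 := by
  have hω := (K.angularVelocity_pos s).ne'
  set L : E3 →L[ℝ] E3 := (Submodule.span ℝ {v})ᗮ.starProjection with hL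
  have hp1 : deriv (K.tantrixProjection v) = fun u => L (deriv K.t u) :=
    deriv_continuousLinearMap_apply L K.contDiff_t
  have hp2 : deriv (fun u => L (deriv K.t u)) = fun u => L (deriv (deriv K.t) u) :=
    deriv_continuousLinearMap_apply L (contDiff_deriv K.contDiff_t)
  rw [IsTantrixInflection, hp1, hp2, ne_eq, K.deriv_t_eq_zero_iff]
  by_cases hk : K.curvature s = 0
  · have hτ : K.torsion s ≠ 0 := by
      intro ht
      have := K.sq_add_sq_pos s
      simp [hk, ht] at this
    simp [hk, d, real_inner_smul_right, hω, hτ]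
  simp only [hk, not_false_eq_true, true_and, false_and, or_false]
  have hLv : L v = 0 :=
    (starProjection_orthogonal_eq_zero_iff v v).2 (Submodule.mem_span_singleton_self v)
  rw [K.deriv_deriv_t, K.deriv_t]
  constructor
  · rintro (h | h)
    · obtain ⟨a, ha⟩ := Submodule.mem_span_singleton.1
        ((starProjection_orthogonal_eq_zero_iff _ _).1 h)
      have h1 := congrArg (fun x => inner ℝ x (K.d s)) ha
      simp only [real_inner_smul_left, K.inner_n_d, mul_zero] at h1
      refine (mul_eq_zero.1 h1).resolve_left ?_
      rintro rfl
      have h2 := congrArg (fun x => inner ℝ x (K.n s)) ha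
      simp [real_inner_smul_left, K.norm_n] at h2
      exact hk h2.symm
    · obtain ⟨c, hc⟩ := Submodule.mem_span_singleton.1 h
      rw [← map_smul, ← sub_eq_zero, ← map_sub] at hc
      obtain ⟨a, ha⟩ := Submodule.mem_span_singleton.1
        ((starProjection_orthogonal_eq_zero_iff _ _).1 hc)
      have h1 := congrArg (fun x => inner ℝ x (K.d s)) ha
      simp only [real_inner_smul_left, inner_sub_left, inner_add_left, K.inner_n_d, K.inner_e_d,
        mul_zero, sub_zero, add_zero] at h1
      refine (mul_eq_zero.1 h1).resolve_left ?_
      rintro rfl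
      have h2 := congrArg (fun x => inner ℝ x (K.e s)) ha
      simp [real_inner_smul_left, inner_sub_left, inner_add_left, K.inner_n_e, K.norm_e, hk, hω]
        at h2
  · intro h
    have hexp := K.expand_ned s v
    rw [real_inner_comm v (K.d s), h, zero_smul, add_zero] at hexp
    set α := inner ℝ (K.n s) v
    set β := inner ℝ (K.e s) v
    have h0 : 0 = α • L (K.n s) + β • L (K.e s) := by
      rw [← hLv, ← map_smul, ← map_smul, ← map_add, ← hexp]
    by_cases hβ : β = 0
    · left
      rw [hβ, zero_smul, add_zero] at hexp h0
      have hα : α ≠ 0 := by rintro hα; rw [hα, zero_smul] at hexp; exact hv hexp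
      rw [map_smul, (smul_eq_zero.1 h0.symm).resolve_left hα, smul_zero]
    · right
      have he : L (K.e s) = (- (α / β)) • L (K.n s) := by
        rw [← sub_eq_zero, ← smul_eq_zero_iff_right hβ, smul_sub, smul_smul, mul_neg,
          mul_div_cancel₀ _ hβ, neg_smul, sub_neg_eq_add, add_comm]
        exact h0.symm
      rw [Submodule.mem_span_singleton, map_smul, map_add, map_smul, map_smul, he]
      refine ⟨(K.curvature s)⁻¹ * (deriv K.curvature s
        + K.curvature s * K.angularVelocity s * (- (α / β))), ?_⟩
      rw [smul_smul, smul_smul, ← add_smul]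
      congr 1
      field_simp

theorem tantrixBridgeMap_eq (q : S2) : K.tantrixBridgeMap q = orthCount K.n K.l q := by
  simp only [tantrixBridgeMap, orthCount, K.isTantrixStationary_iff]

theorem tantrixInflectionMap_eq (q : S2) : K.tantrixInflectionMap q = orthCount K.d K.l q := by
  have hq : (q : E3) ≠ 0 := norm_ne_zero_iff.1 (by rw [show ‖(q : E3)‖ = 1 by simp]; simp)
  simp only [tantrixInflectionMap, orthCount, K.isTantrixInflection_iff hq]

/-! ### The bridge graph -/

theorem inner_deriv_n (v : E3) (s : ℝ) :
    inner ℝ v (deriv K.n s) = K.angularVelocity s * inner ℝ v (K.e s) := by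
  rw [K.deriv_n_eq_smul_e, real_inner_smul_right]

theorem inner_deriv_d (v : E3) (s : ℝ) :
    inner ℝ v (deriv K.d s) = K.darbouxSpeed s * inner ℝ v (K.e s) := by
  rw [K.deriv_d, real_inner_smul_right]

/-- The cone over the Darboux indicatrix is the image of a plane under a smooth map, so its
complement is dense; off this cone the count is finite. -/
theorem orthCount_n_ne_top_of_eventually {v : E3} {c : ℕ∞}
    (hc : ∀ᶠ x in 𝓝 v, orthCount K.n K.l x = c) : c ≠ ⊤ := by
  have hf : ContDiff ℝ 1 fun p : ℝ × ℝ => p.1 • K.d p.2 :=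
    contDiff_fst.smul ((K.contDiff_d.of_le (by norm_cast)).comp contDiff_snd)
  have hd := hf.dense_compl_range_of_finrank_lt_finrank (by simp)
  obtain ⟨x, hx, hxc⟩ := hd.inter_nhds_nonempty hc
  have hxc : orthCount K.n K.l x = c := hxc
  rw [← hxc]
  refine (K.isSignPeriodic_n.orthCount_upper fun s hs hs' => hx ?_).1
  rw [K.inner_deriv_n] at hs'
  exact ⟨(inner ℝ (K.d s) x, s), (K.eq_smul_d hs
    ((mul_eq_zero.1 hs').resolve_left (K.angularVelocity_pos s).ne')).symm⟩

theorem mem_tantrixBridgeGraph_iff (p : S2) :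
    p ∈ K.tantrixBridgeGraph ↔ ∃ s, (p : E3) = K.d s ∨ (p : E3) = - K.d s := by
  have hp : ‖(p : E3)‖ = 1 := by simp
  rw [tantrixBridgeGraph, mem_sphereMapGraph_iff K.tantrixBridgeMap_eq]
  constructor
  · intro h
    by_contra! hcon
    refine h _ (K.isSignPeriodic_n.eventually_orthCount_eq fun s hs hs' => ?_)
    rw [K.inner_deriv_n] at hs'
    rcases eq_or_eq_neg_of_eq_smul hp (K.norm_d s) (K.eq_smul_d hs
      ((mul_eq_zero.1 hs').resolve_left (K.angularVelocity_pos s).ne')) with h | h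
    · exact (hcon s).1 h
    · exact (hcon s).2 h
  · rintro ⟨s, hs⟩ c hc
    have hd : ∀ x : E3, inner ℝ x (K.d s) = 0 → inner ℝ (p : E3) x = 0 := by
      intro x hx
      rcases hs with hs | hs <;> rw [hs, real_inner_comm] <;> simp [hx]
    refine K.isSignPeriodic_n.not_eventually_orthCount_eq_of_degenerate (w := K.e s) (s₀ := s)
      ?_ (hd _ (K.inner_n_d s)) ?_ ?_ ?_ c hc
    · rw [hc.self_of_nhds]; exact K.orthCount_n_ne_top_of_eventually hc
    · rw [K.inner_deriv_n, hd _ (K.inner_e_d s), mul_zero]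
    · rw [real_inner_comm, K.inner_n_e]
    · rw [K.inner_deriv_n, real_inner_self_eq_norm_sq, K.norm_e]
      simpa using (K.angularVelocity_pos s).ne'

/-! ### The inflection graph -/

/-- At a cusp, the speed of the Darboux indicatrix changes its sign. -/
theorem exists_sign_of_hasCuspAt {s : ℝ} (h : HasCuspAt K.d s) :
    ∃ q : ℝ, q ≠ 0 ∧ ∀ᶠ u in 𝓝[≠] s, 0 < q * K.darbouxSpeed u * (u - s) := by
  obtain ⟨E, hE, hr, hl⟩ := h
  have hlam : ∀ u, inner ℝ (‖deriv K.d u‖⁻¹ • deriv K.d u) (K.e u)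
      = |K.darbouxSpeed u|⁻¹ * K.darbouxSpeed u := by
    intro u
    rw [K.deriv_d, norm_smul, K.norm_e, mul_one, Real.norm_eq_abs, real_inner_smul_left,
      real_inner_smul_left, real_inner_self_eq_norm_sq, K.norm_e]
    ring
  have hvec : ∀ u, ‖deriv K.d u‖⁻¹ • deriv K.d u
      = (|K.darbouxSpeed u|⁻¹ * K.darbouxSpeed u) • K.e u := by
    intro u
    rw [K.deriv_d, norm_smul, K.norm_e, mul_one, Real.norm_eq_abs, smul_smul]
  have he : Filter.Tendsto K.e (𝓝 s) (𝓝 (K.e s)) := K.contDiff_e.continuous.tendsto s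
  set q := inner ℝ E (K.e s) with hq
  have hr1 : Filter.Tendsto (fun u => |K.darbouxSpeed u|⁻¹ * K.darbouxSpeed u) (𝓝[>] s) (𝓝 q) := by
    simpa only [hlam] using hr.inner (he.mono_left nhdsWithin_le_nhds) (𝕜 := ℝ)
  have hl1 : Filter.Tendsto (fun u => |K.darbouxSpeed u|⁻¹ * K.darbouxSpeed u) (𝓝[<] s)
      (𝓝 (-q)) := by
    simpa only [hlam, inner_neg_left] using hl.inner (he.mono_left nhdsWithin_le_nhds) (𝕜 := ℝ)
  have hEq : E = q • K.e s := by
    refine tendsto_nhds_unique hr ?_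
    simp only [hvec]
    exact hr1.smul (he.mono_left nhdsWithin_le_nhds)
  have hq0 : q ≠ 0 := by
    intro h0
    rw [hEq, h0, zero_smul, norm_zero] at hE
    exact zero_ne_one hE
  refine ⟨q, hq0, ?_⟩
  have hsq : 0 < q * q := mul_self_pos.2 hq0
  have hpos : ∀ c x : ℝ, 0 < c * (|x|⁻¹ * x) → 0 < c * x := by
    intro c x h
    rw [mul_left_comm] at h
    exact pos_of_mul_pos_right h (inv_nonneg.2 (abs_nonneg x))
  rw [← nhdsLT_sup_nhdsGT, Filter.eventually_sup]
  constructor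
  · have h1 := hl1.const_mul (-q)
    rw [neg_mul_neg] at h1
    filter_upwards [h1.eventually_const_lt hsq, self_mem_nhdsWithin] with u hu hus
    have := hpos _ _ hu
    have hus : u < s := hus
    nlinarith
  · filter_upwards [(hr1.const_mul q).eventually_const_lt hsq, self_mem_nhdsWithin] with u hu hus
    have := hpos _ _ hu
    have hus : s < u := hus
    exact mul_pos this (by linarith)

variable {K}

theorem StationaryPointsAreCusps.eventually_darbouxSpeed_ne (h : K.StationaryPointsAreCusps)
    (s : ℝ) : ∀ᶠ u in 𝓝[≠] s, K.darbouxSpeed u ≠ 0 := by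
  by_cases hs : K.darbouxSpeed s = 0
  · obtain ⟨q, -, hq⟩ := K.exists_sign_of_hasCuspAt
      (h s ((K.geodesicCurvatureStationaryAt_iff s).2 hs))
    filter_upwards [hq] with u hu h0
    simp [h0] at hu
  · exact ((K.continuous_darbouxSpeed.tendsto s).eventually_ne hs).filter_mono nhdsWithin_le_nhds

theorem StationaryPointsAreCusps.orthCount_d_ne_top (h : K.StationaryPointsAreCusps)
    {v : E3} (hv : v ≠ 0) : orthCount K.d K.l v ≠ ⊤ := by
  rw [orthCount, Set.encard_ne_top_iff]
  refine (finite_of_eventually_not (P := fun s => inner ℝ v (K.d s) = 0) 0 K.l fun s => ?_).subset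
    fun s hs => ⟨Set.Ico_subset_Icc_self hs.1, hs.2⟩
  by_cases hs : inner ℝ v (K.d s) = 0
  swap
  · exact ((K.isSignPeriodic_d.continuous_inner v).tendsto s).eventually_ne hs |>.filter_mono
      nhdsWithin_le_nhds
  have hder : ∀ᶠ u in 𝓝[≠] s, inner ℝ v (K.e u) ≠ 0 := by
    have hc : Continuous fun u => inner ℝ v (K.e u) :=
      continuous_const.inner K.contDiff_e.continuous
    by_cases he : inner ℝ v (K.e s) = 0
    · have hvn := K.eq_smul_n hs he
      have hn0 : inner ℝ (K.n s) v ≠ 0 := by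
        intro h0; rw [h0, zero_smul] at hvn; exact hv hvn
      have hd := (hasDerivAt_const s v).inner ℝ
        ((K.contDiff_e.differentiable (by simp)) s).hasDerivAt
      have hne : inner ℝ v (deriv K.e s) + inner ℝ (0 : E3) (K.e s) ≠ 0 := by
        rw [inner_zero_left, add_zero, hvn, real_inner_smul_left, K.inner_n_deriv_e]
        exact mul_ne_zero hn0 (neg_ne_zero.2 (K.angularVelocity_pos s).ne')
      exact hd.eventually_ne hne
    · exact ((hc.tendsto s).eventually_ne he).filter_mono nhdsWithin_le_nhds
  have := eventually_ne_of_deriv_ne (s := s) (K.isSignPeriodic_d.hasDerivAt_inner v) (by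
    filter_upwards [hder, h.eventually_darbouxSpeed_ne s] with u h1 h2
    rw [K.inner_deriv_d]
    exact mul_ne_zero h2 h1)
  simpa only [hs] using this

/-- A double zero of `⟪v, d⟫` at a regular point of the Darboux indicatrix puts `v` on the
inflection graph. -/
theorem StationaryPointsAreCusps.not_eventually_of_regular (h : K.StationaryPointsAreCusps)
    {v : E3} (hv : v ≠ 0) {s : ℝ} (hs : K.darbouxSpeed s ≠ 0) (hd : inner ℝ v (K.d s) = 0)
    (he : inner ℝ v (K.e s) = 0) (c : ℕ∞) : ¬ ∀ᶠ x in 𝓝 v, orthCount K.d K.l x = c := by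
  refine K.isSignPeriodic_d.not_eventually_orthCount_eq_of_degenerate (w := K.e s)
    (h.orthCount_d_ne_top hv) hd ?_ (K.inner_e_d s) ?_ c
  · rw [K.inner_deriv_d, he, mul_zero]
  · rw [K.inner_deriv_d, real_inner_self_eq_norm_sq, K.norm_e]
    simpa using hs

theorem darbouxSpeed_toIcoMod (s : ℝ) (hs : K.darbouxSpeed s = 0) :
    K.darbouxSpeed (toIcoMod K.l_pos 0 s) = 0 := by
  have h1 : deriv K.d (toIcoMod K.l_pos 0 s) = deriv K.d s :=
    (periodic_deriv K.periodic_d).sub_zsmul_eq _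
  rw [darbouxSpeed, h1, K.deriv_d, hs, zero_smul, inner_zero_right]

/-- The great circle orthogonal to a cusp `d s₀` belongs to the inflection graph. As the graph is
closed, it suffices to find points of it on the great circle arbitrarily near a given one. Almost
every point is on no other such great circle, and not at `± n s₀`: then either it is on the notrix
or anti-notrix at a regular point of the Darboux indicatrix, or `⟪v, d⟫` has an extremum at `s₀`
and no other degenerate zeros. -/
theorem StationaryPointsAreCusps.not_eventually_of_stationary (h : K.StationaryPointsAreCusps)
    (hcusps : K.DarbouxCuspsDistinct) {v₀ : E3} {s₀ : ℝ} (hs₀ : K.darbouxSpeed s₀ = 0)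
    (hv₀ : inner ℝ v₀ (K.d s₀) = 0) (c : ℕ∞) :
    ¬ ∀ᶠ x in 𝓝 v₀, orthCount K.d K.l x = c := by
  intro hc
  have hfin := finite_of_eventually_not (P := fun s => K.darbouxSpeed s = 0) 0 K.l
    h.eventually_darbouxSpeed_ne
  -- along this curve in the plane orthogonal to `d s₀`, a linear functional that does not vanish on
  -- the plane becomes a nonconstant polynomial in `x`, so it vanishes at isolated points only
  have hinner : ∀ (x : ℝ) (w : E3), inner ℝ (v₀ + x • K.n s₀ + x ^ 2 • K.e s₀) w
      = inner ℝ v₀ w + x * inner ℝ (K.n s₀) w + x ^ 2 * inner ℝ (K.e s₀) w := by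
    intro x w; simp only [inner_add_left, real_inner_smul_left]
  have hpath : Filter.Tendsto (fun x : ℝ => v₀ + x • K.n s₀ + x ^ 2 • K.e s₀) (𝓝[≠] 0) (𝓝 v₀) := by
    have : Continuous fun x : ℝ => v₀ + x • K.n s₀ + x ^ 2 • K.e s₀ := by fun_prop
    simpa using (this.tendsto 0).mono_left nhdsWithin_le_nhds
  have he₀ : ∀ᶠ x : ℝ in 𝓝[≠] 0, inner ℝ (v₀ + x • K.n s₀ + x ^ 2 • K.e s₀) (K.e s₀) ≠ 0 := by
    simp only [hinner]
    exact eventually_quadratic_ne (.inr (by simp [K.norm_e]))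
  have hother : ∀ᶠ x : ℝ in 𝓝[≠] 0, ∀ z ∈ {s ∈ Set.Icc 0 K.l | K.darbouxSpeed s = 0},
      inner ℝ (v₀ + x • K.n s₀ + x ^ 2 • K.e s₀) (K.d z) = 0 →
        K.d z = K.d s₀ ∨ K.d z = - K.d s₀ := by
    refine (Filter.eventually_all_finite hfin).2 fun z _ => ?_
    by_cases hz : inner ℝ (K.n s₀) (K.d z) ≠ 0 ∨ inner ℝ (K.e s₀) (K.d z) ≠ 0
    · filter_upwards [eventually_quadratic_ne (a := inner ℝ v₀ (K.d z)) hz] with x hx h0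
      rw [hinner] at h0
      exact (hx h0).elim
    · push Not at hz
      refine Filter.Eventually.of_forall fun x _ => eq_or_eq_neg_of_eq_smul (K.norm_d z)
        (K.norm_d s₀) (K.eq_smul_d ?_ ?_)
      · rw [real_inner_comm]; exact hz.1
      · rw [real_inner_comm]; exact hz.2
  obtain ⟨x, hxe, hxo, hxc⟩ :=
    (he₀.and (hother.and (hpath.eventually (eventually_eventually_nhds.2 hc)))).exists
  have hvd : inner ℝ (v₀ + x • K.n s₀ + x ^ 2 • K.e s₀) (K.d s₀) = 0 := by
    rw [hinner, hv₀, K.inner_n_d, K.inner_e_d]; ring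
  set v := v₀ + x • K.n s₀ + x ^ 2 • K.e s₀
  have hv : v ≠ 0 := by
    intro h0; rw [h0, inner_zero_left] at hxe; exact hxe rfl
  by_cases hreg : ∃ z, K.darbouxSpeed z ≠ 0 ∧ inner ℝ v (K.d z) = 0 ∧ inner ℝ v (K.e z) = 0
  · obtain ⟨z, hz, hzd, hze⟩ := hreg
    exact h.not_eventually_of_regular hv hz hzd hze c hxc
  push Not at hreg
  have hcusp : ∀ s, K.darbouxSpeed s = 0 → HasCuspAt K.d s := fun s hs =>
    h s ((K.geodesicCurvatureStationaryAt_iff s).2 hs)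
  obtain ⟨q, hq0, hq⟩ := K.exists_sign_of_hasCuspAt (hcusp s₀ hs₀)
  have hdmod : ∀ s, K.d (toIcoMod K.l_pos 0 s) = K.d s := fun s => K.periodic_d.sub_zsmul_eq _
  refine K.isSignPeriodic_d.not_eventually_orthCount_eq_of_extremum
    (k := q * inner ℝ v (K.e s₀)) (h.orthCount_d_ne_top hv) hvd (mul_ne_zero hq0 hxe) ?_
    (norm_ne_zero_iff.1 (by rw [K.norm_d]; exact one_ne_zero)) ?_ c hxc
  · refine eventually_nonneg_of_deriv
      (fun u => (K.isSignPeriodic_d.hasDerivAt_inner v u).const_mul _) (by rw [hvd, mul_zero]) ?_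
    have hcont : Continuous fun u => inner ℝ v (K.e s₀) * inner ℝ v (K.e u) :=
      continuous_const.mul (continuous_const.inner K.contDiff_e.continuous)
    have hpos := ((hcont.tendsto s₀).eventually_const_lt (mul_self_pos.2 hxe)).filter_mono
      (nhdsWithin_le_nhds (s := {s₀}ᶜ))
    filter_upwards [hq, hpos] with u h1 h2
    rw [K.inner_deriv_d]
    have := mul_pos h1 h2
    linarith
  · intro s hsl hne hsd hsd'
    rw [K.inner_deriv_d] at hsd'
    have hs : K.darbouxSpeed s = 0 := by
      by_contra hs
      exact hreg s hs hsd ((mul_eq_zero.1 hsd').resolve_left hs)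
    have hmem : ∀ s, toIcoMod K.l_pos 0 s ∈ Set.Ico 0 K.l := fun s => by
      simpa using toIcoMod_mem_Ico K.l_pos 0 s
    have hdz := hxo (toIcoMod K.l_pos 0 s)
      ⟨Set.Ico_subset_Icc_self (hmem s), darbouxSpeed_toIcoMod s hs⟩ (by rw [hdmod]; exact hsd)
    rw [← hdmod s₀] at hdz
    have heq := hcusps _ (hmem s) _ (hmem s₀) (hcusp _ (darbouxSpeed_toIcoMod s hs))
      (hcusp _ (darbouxSpeed_toIcoMod s₀ hs₀)) hdz
    obtain ⟨k, hk⟩ := (toIcoMod_eq_toIcoMod K.l_pos).1 heq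
    have hl := K.l_pos
    rw [abs_sub_comm, hk, zsmul_eq_mul, abs_mul, abs_of_pos hl] at hsl
    have hk1 : |(k : ℝ)| < 1 := by nlinarith
    have hk0 : k = 0 := by
      rw [← Int.cast_abs] at hk1
      exact Int.abs_lt_one_iff.1 (by exact_mod_cast hk1)
    rw [hk0, zero_smul, sub_eq_zero] at hk
    exact hne hk.symm

variable (K)

theorem mem_tangentGreatCircle_n_iff (s : ℝ) (x : E3) :
    x ∈ tangentGreatCircle K.n s ↔ ‖x‖ = 1 ∧ inner ℝ x (K.d s) = 0 := by
  rw [tangentGreatCircle, Set.mem_ofPred_eq, Submodule.mem_span_pair, K.deriv_n_eq_smul_e]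
  refine and_congr_right fun _ => ⟨?_, fun h => ?_⟩
  · rintro ⟨a, b, rfl⟩
    simp [inner_add_left, real_inner_smul_left, K.inner_n_d, K.inner_e_d]
  · refine ⟨inner ℝ (K.n s) x, inner ℝ (K.e s) x * (K.angularVelocity s)⁻¹, ?_⟩
    rw [smul_smul, mul_assoc, inv_mul_cancel₀ (K.angularVelocity_pos s).ne', mul_one]
    have hx := K.expand_ned s x
    rw [real_inner_comm x (K.d s), h, zero_smul, add_zero] at hx
    exact hx.symm

theorem tangentGreatCircle_neg (γ : ℝ → E3) (s : ℝ) :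
    tangentGreatCircle (fun u => - γ u) s = tangentGreatCircle γ s := by
  ext x
  simp only [tangentGreatCircle, Set.mem_ofPred_eq, Submodule.mem_span_pair, deriv.fun_neg]
  refine and_congr_right fun _ => ⟨?_, ?_⟩ <;>
  · rintro ⟨a, b, rfl⟩
    exact ⟨-a, -b, by module⟩

variable {K}

theorem StationaryPointsAreCusps.mem_tantrixInflectionGraph_iff
    (h : K.StationaryPointsAreCusps) (hcusps : K.DarbouxCuspsDistinct) (p : S2) :
    p ∈ K.tantrixInflectionGraph ↔ (∃ s, (p : E3) = K.n s ∨ (p : E3) = - K.n s) ∨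
      ∃ s, K.darbouxSpeed s = 0 ∧ inner ℝ (p : E3) (K.d s) = 0 := by
  have hp : ‖(p : E3)‖ = 1 := by simp
  rw [tantrixInflectionGraph, mem_sphereMapGraph_iff K.tantrixInflectionMap_eq]
  constructor
  · intro hg
    by_contra! hcon
    refine hg _ (K.isSignPeriodic_d.eventually_orthCount_eq fun s hs hs' => ?_)
    rw [K.inner_deriv_d] at hs'
    rcases mul_eq_zero.1 hs' with h0 | h0
    · exact hcon.2 s h0 hs
    · rcases eq_or_eq_neg_of_eq_smul hp (K.norm_n s) (K.eq_smul_n hs h0) with h1 | h1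
      · exact (hcon.1 s).1 h1
      · exact (hcon.1 s).2 h1
  · rintro (⟨s, hs⟩ | ⟨s, hs, hd⟩) c
    · have hn : ∀ x : E3, inner ℝ (K.n s) x = 0 → inner ℝ (p : E3) x = 0 := by
        intro x hx
        rcases hs with hs | hs <;> rw [hs] <;> simp [hx]
      by_cases h0 : K.darbouxSpeed s = 0
      · exact h.not_eventually_of_stationary hcusps h0 (hn _ (K.inner_n_d s)) c
      · exact h.not_eventually_of_regular (norm_ne_zero_iff.1 (by rw [hp]; exact one_ne_zero)) h0
          (hn _ (K.inner_n_d s)) (hn _ (K.inner_n_e s)) c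
    · exact h.not_eventually_of_stationary hcusps hs hd c

end SmoothKnot

end

theorem mainTheorem2 (K : SmoothKnot) (hcusps : K.DarbouxCuspsDistinct) :
    (Subtype.val '' K.tantrixBridgeGraph : Set E3)
        = Set.range K.d ∪ Set.range (fun s => - K.d s) ∧
    (K.StationaryPointsAreCusps →
      (Subtype.val '' K.tantrixInflectionGraph : Set E3)
        = Set.range K.n ∪ Set.range (fun s => - K.n s) ∪
          ⋃ s ∈ {s : ℝ | K.GeodesicCurvatureStationaryAt s},
            (tangentGreatCircle K.n s ∪ tangentGreatCircle (fun u => - K.n u) s)) := by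
  refine ⟨?_, fun h => ?_⟩
  · ext x
    constructor
    · rintro ⟨p, hp, rfl⟩
      obtain ⟨s, hs | hs⟩ := (K.mem_tantrixBridgeGraph_iff p).1 hp
      · exact .inl ⟨s, hs.symm⟩
      · exact .inr ⟨s, hs.symm⟩
    · rintro (⟨s, rfl⟩ | ⟨s, rfl⟩)
      · exact ⟨⟨K.d s, by simp [K.norm_d]⟩,
          (K.mem_tantrixBridgeGraph_iff _).2 ⟨s, .inl rfl⟩, rfl⟩
      · exact ⟨⟨- K.d s, by simp [K.norm_d]⟩,
          (K.mem_tantrixBridgeGraph_iff _).2 ⟨s, .inr rfl⟩, rfl⟩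
  · ext x
    simp only [SmoothKnot.tangentGreatCircle_neg, Set.union_self, Set.mem_union, Set.mem_iUnion₂,
      Set.mem_ofPred_eq, K.geodesicCurvatureStationaryAt_iff, K.mem_tangentGreatCircle_n_iff]
    constructor
    · rintro ⟨p, hp, rfl⟩
      rcases (h.mem_tantrixInflectionGraph_iff hcusps p).1 hp with
        ⟨s, hs | hs⟩ | ⟨s, hs, hd⟩
      · exact .inl (.inl ⟨s, hs.symm⟩)
      · exact .inl (.inr ⟨s, hs.symm⟩)
      · exact .inr ⟨s, hs, by simp, hd⟩
    · rintro ((⟨s, rfl⟩ | ⟨s, rfl⟩) | ⟨s, hs, hx, hd⟩)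
      · exact ⟨⟨K.n s, by simp [K.norm_n]⟩,
          (h.mem_tantrixInflectionGraph_iff hcusps _).2 (.inl ⟨s, .inl rfl⟩), rfl⟩
      · exact ⟨⟨- K.n s, by simp [K.norm_n]⟩,
          (h.mem_tantrixInflectionGraph_iff hcusps _).2 (.inl ⟨s, .inr rfl⟩), rfl⟩
      · exact ⟨⟨x, by simpa using hx⟩,
          (h.mem_tantrixInflectionGraph_iff hcusps _).2 (.inr ⟨s, hs, hd⟩), rfl⟩
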